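/- Let $n\ge 0$ be an integer, and write $\mathbb{T}^n=(\mathbb{R}/\mathbb{Z})^n$, equipped with its normalised Haar measure; a function on $\mathbb{T}^n$ is smooth if its periodic lift to $\mathbb{R}^n$ is $C^\infty$. For a multi-index $\alpha\in\mathbb{N}_0^n$ put $|\alpha|=\sum_j\alpha_j$, $\alpha!=\prod_j\alpha_j!$, $k^\alpha=\prod_j k_j^{\alpha_j}$, and, for $k\in\mathbb{Z}^n$, let $|k|$ be the Euclidean norm. Let $\Delta_{k_j}f(k)=f(k+e_j)-f(k)$, $\Delta_k^\alpha=\Delta_{k_1}^{\alpha_1}\cdots\Delta_{k_n}^{\alpha_n}$, $D_{x_j}=\frac{1}{2\pi i}\frac{\partial}{\partial x_j}$, $D_{x_j}^{(\ell)}=\prod_{r=0}^{\ell-1}(D_{x_j}-r)$ (so $D_{x_j}^{(0)}=I$), and $D_x^{(\alpha)}=D_{x_1}^{(\alpha_1)}\cdots D_{x_n}^{(\alpha_n)}$. Let $\Lambda:\mathbb{Z}^n\to\mathbb{R}$ be a weight function of parameter $\mu$: there are positive constants $\mu_0\le\mu_1\le\mu$ and $C_0,C_1$ with $C_0(1+|k|)^{\mu_0}\le\Lambda(k)\le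 C_1(1+|k|)^{\mu_1}$ for all $k\in\mathbb{Z}^n$, and for all $\alpha\in\mathbb{N}_0^n$, $\gamma\in\{0,1\}^n$ there is $C_{\alpha,\gamma}>0$ with $|k^\gamma\Delta_k^{\alpha+\gamma}\Lambda(k)|\le C_{\alpha,\gamma}\Lambda(k)^{1-|\alpha|/\mu}$ for all $k$. Let $0<\rho\le 1/\mu$. For $m\in\mathbb{R}$, $S^m_{\rho,\Lambda}$ is the set of $\sigma:\mathbb{Z}^n\times\mathbb{T}^n\to\mathbb{C}$ that are smooth in $x$ for every $k$ and such that for all $\alpha,\beta\in\mathbb{N}_0^n$ there is $C_{\alpha,\beta}>0$ with $|D_x^{(\beta)}\Delta_k^\alpha\sigma(k,x)|\le C_{\alpha,\beta}\Lambda(k)^{m-\rho|\alpha|}$ for all $(k,x)$; and $M^m_{\rho,\Lambda}$ is the set of $\sigma$, smooth in $x$ for every $k$, such that $k^\gamma\Delta_k^\gamma\sigma\in S^m_{\rho,\Lambda}$ for all $\gamma\in\{0,1\}^n$. Let $\mathcal{S}(\mathbb{Z}^n)$ be the space of functions $f:\mathbb{Z}^n\to\mathbb{C}$ with $\sup_k(1+|k|)^M|f(k)|<\infty$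 for every $M\in\mathbb{N}_0$. For $f\in\mathcal{S}(\mathbb{Z}^n)$ put $\widehat f(x)=\sum_{k\in\mathbb{Z}^n}e^{-2\pi i k\cdot x}f(k)$, and $$T_\sigma f(k)=\int_{\mathbb{T}^n}e^{2\pi i k\cdot x}\sigma(k,x)\widehat f(x)\,dx,\qquad k\in\mathbb{Z}^n.$$ **Theorem (composition formula).** Let $m_1,m_2\in\mathbb{R}$, $\sigma\in M^{m_1}_{\rho,\Lambda}$ and $\tau\in M^{m_2}_{\rho,\Lambda}$. Then $T_\sigma$ and $T_\tau$ map $\mathcal{S}(\mathbb{Z}^n)$ into itself, and there is a symbol $\lambda\in M^{m_1+m_2}_{\rho,\Lambda}$ such that $T_\sigma T_\tau f=T_\lambda f$ for every $f\in\mathcal{S}(\mathbb{Z}^n)$ and, for every $N\in\mathbb{N}_0$, $$\lambda(k,x)-\sum_{|\alpha|<N}\frac{1}{\alpha!}\bigl(D_x^{(\alpha)}\sigma(k,x)\bigr)\,\Delta_k^\alpha\tau(k,x)\in M^{m_1+m_2-\rho N}_{\rho,\Lambda}.$$ -/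

import Mathlib

open MeasureTheory

noncomputable section

namespace LatticePDO

variable {n : ℕ}

/-- The normalised Haar measure on `𝕋ⁿ = (ℝ / ℤ)ⁿ` (total mass one). -/
def torusMeasure (n : ℕ) : Measure (UnitAddTorus (Fin n)) :=
  Measure.pi fun _ => AddCircle.haarAddCircle

/-- The length `|α| = α₁ + ⋯ + αₙ` of a multi-index. -/
def miLength (α : Fin n → ℕ) : ℕ := ∑ i, α i

/-- The factorial `α! = α₁! ⋯ αₙ!` of a multi-index. -/
def miFactorial (α : Fin n → ℕ) : ℕ := ∏ i, (α i).factorial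

/-- The Euclidean length `|k|` of a lattice point. -/
def latticeNorm (k : Fin n → ℤ) : ℝ := Real.sqrt (∑ i, (k i : ℝ) ^ 2)

/-- The iterated difference operator `Δ_k^α = Δ_{k₁}^{α₁} ⋯ Δ_{kₙ}^{αₙ}`, where
`(Δ_{k_j} f)(k) = f(k + e_j) - f(k)`. The values of `f` may be numbers or functions on the torus. -/
def latticeDiff {G : Type*} [AddCommGroup G] (α : Fin n → ℕ) (f : (Fin n → ℤ) → G) :
    (Fin n → ℤ) → G :=
  (List.finRange n).foldr (fun j g => (fwdDiff (Pi.single j (1 : ℤ)))^[α j] g) f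

/-- A function on the torus is smooth if its `ℤⁿ`-periodic lift to `ℝⁿ` is `C^∞`. -/
def IsSmooth (g : UnitAddTorus (Fin n) → ℂ) : Prop :=
  ContDiff ℝ (⊤ : ℕ∞) fun x : Fin n → ℝ => g fun i => (x i : UnitAddCircle)

/-- `D_{x_j} = (2πi)⁻¹ ∂/∂x_j` on functions on the torus. -/
def torusD (j : Fin n) (g : UnitAddTorus (Fin n) → ℂ) (x : UnitAddTorus (Fin n)) : ℂ :=
  (2 * Real.pi * Complex.I)⁻¹ *
    deriv (fun t : ℝ => g (x + Pi.single j (t : UnitAddCircle))) 0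

/-- `D_{x_j}^{(ℓ)} = D_{x_j} (D_{x_j} - 1) ⋯ (D_{x_j} - (ℓ - 1))`, with `D_{x_j}^{(0)} = I`. -/
def torusDFall (j : Fin n) : ℕ → (UnitAddTorus (Fin n) → ℂ) → UnitAddTorus (Fin n) → ℂ
  | 0, g => g
  | l + 1, g => fun x => torusD j (torusDFall j l g) x - (l : ℂ) * torusDFall j l g x

/-- `D_x^{(β)} = D_{x₁}^{(β₁)} ⋯ D_{xₙ}^{(βₙ)}`. -/
def torusDiff (β : Fin n → ℕ) (g : UnitAddTorus (Fin n) → ℂ) : UnitAddTorus (Fin n) → ℂ :=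
  (List.finRange n).foldr (fun j h => torusDFall j (β j) h) g

/-- `Λ` is a weight function on `ℤⁿ` with order parameter `μ`. -/
def IsWeight (μ : ℝ) (Λ : (Fin n → ℤ) → ℝ) : Prop :=
  (∃ μ₀ μ₁ C₀ C₁ : ℝ, 0 < μ₀ ∧ μ₀ ≤ μ₁ ∧ μ₁ ≤ μ ∧ 0 < C₀ ∧ 0 < C₁ ∧
    ∀ k, C₀ * (1 + latticeNorm k) ^ μ₀ ≤ Λ k ∧ Λ k ≤ C₁ * (1 + latticeNorm k) ^ μ₁) ∧
  ∀ α γ : Fin n → ℕ, (∀ i, γ i ≤ 1) → ∃ C : ℝ, 0 < C ∧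
    ∀ k, |(∏ i, (k i : ℝ) ^ γ i) * latticeDiff (α + γ) Λ k| ≤
      C * Λ k ^ (1 - 1 / μ * (miLength α : ℝ))

/-- The symbol class `S^m_{ρ,Λ}(ℤⁿ × 𝕋ⁿ)`. -/
def symbolS (ρ : ℝ) (Λ : (Fin n → ℤ) → ℝ) (m : ℝ) :
    Set ((Fin n → ℤ) → UnitAddTorus (Fin n) → ℂ) :=
  {σ | (∀ k, IsSmooth (σ k)) ∧
    ∀ α β : Fin n → ℕ, ∃ C : ℝ, 0 < C ∧
      ∀ k x, ‖torusDiff β (latticeDiff α σ k) x‖ ≤ C * Λ k ^ (m - ρ * (miLength α : ℝ))}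

/-- The symbol class `M^m_{ρ,Λ}(ℤⁿ × 𝕋ⁿ)`: `k^γ Δ_k^γ σ ∈ S^m_{ρ,Λ}` for all `γ ∈ {0,1}ⁿ`. -/
def symbolM (ρ : ℝ) (Λ : (Fin n → ℤ) → ℝ) (m : ℝ) :
    Set ((Fin n → ℤ) → UnitAddTorus (Fin n) → ℂ) :=
  {σ | (∀ k, IsSmooth (σ k)) ∧
    ∀ γ : Fin n → ℕ, (∀ i, γ i ≤ 1) →
      (fun k x => (∏ i, (k i : ℂ) ^ γ i) * latticeDiff γ σ k x) ∈ symbolS ρ Λ m}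

/-- The space `𝓢(ℤⁿ)` of rapidly decreasing functions on the lattice. -/
def latticeSchwartz (n : ℕ) : Set ((Fin n → ℤ) → ℂ) :=
  {f | ∀ M : ℕ, ∃ C : ℝ, ∀ k, (1 + latticeNorm k) ^ M * ‖f k‖ ≤ C}

/-- The Fourier transform `f̂(x) = ∑_k e^{-2πi k·x} f(k)` of a function on the lattice. -/
def latticeFourier (f : (Fin n → ℤ) → ℂ) (x : UnitAddTorus (Fin n)) : ℂ :=
  ∑' k : Fin n → ℤ, UnitAddTorus.mFourier (-k) x * f k

/-- The pseudo-differential operator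
`(T_σ f)(k) = ∫_{𝕋ⁿ} e^{2πi k·x} σ(k,x) f̂(x) dx`. -/
def pdo (σ : (Fin n → ℤ) → UnitAddTorus (Fin n) → ℂ) (f : (Fin n → ℤ) → ℂ) (k : Fin n → ℤ) : ℂ :=
  ∫ x, UnitAddTorus.mFourier k x * σ k x * latticeFourier f x ∂(torusMeasure n)

/-- The partial sum `∑_{|α| < N} (1/α!) (D_x^{(α)} σ)(k,x) (Δ_k^α τ)(k,x)`. The index set
`Finset.univ.piAntidiag d` is the set of multi-indices of length `d`. -/
def compositionExpansion (σ τ : (Fin n → ℤ) → UnitAddTorus (Fin n) → ℂ) (N : ℕ)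
    (k : Fin n → ℤ) (x : UnitAddTorus (Fin n)) : ℂ :=
  ∑ d ∈ Finset.range N, ∑ α ∈ (Finset.univ : Finset (Fin n)).piAntidiag d,
    (1 / (miFactorial α : ℂ)) * torusDiff α (σ k) x * latticeDiff α τ k x

end LatticePDO

end

/-! Everything is done on the Fourier coefficients of the symbols in `x`. If `a k p` and `b k p` are
the coefficients of `σ k` and `τ k`, then `T_σ f(k) = ∑_p a(k,p) f(k+p)`, so the composite is the
operator of the same kind with coefficients `c(k,l) = ∑_j a(k,j) b(k+j, l-j)`. Newton's formula
expands `b(k+j, ·)` about `k` as `∑_α (j^{(α)}/α!) Δ^α b(k, ·)`. Since `j^{(α)} a(k,j)` is the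
coefficient of `D_x^{(α)} σ`, the terms with `|α| < N` are exactly the coefficients of the stated
expansion, and what is left over is `compCoef N`.

Three facts make this quantitative. Membership in `M^m_{ρ,Λ}` is equivalent to rapid decay of the
coefficients in `j` together with estimates on their differences in `k` (`mem_symbolM_iff`). The
Newton remainder of order `N` is bounded by the differences of order `N`, with a loss polynomial in
`j` (`exists_taylorRem_le`); this needs powers of `Λ` to change at most polynomially under
translation, which follows because `Λ^{1/μ}` is Lipschitz (`IsWeight.isTemperate_rpow`). Finally,
the rapid decay of `a k j` in `j` absorbs the loss (`compCoef_mem_coefClass`).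

The factors `k^γ Δ^γ` in the definition of `M` interact badly with products and with Taylor
remainders. They are therefore replaced by marked letters in words of differences: a difference in a
marked direction `i` must gain `1 + |k_i|`, an unmarked one gains `Λ^ρ`, and marked directions are
distinct. This form passes to subwords, which is what the Leibniz rule requires. -/

noncomputable section

namespace LatticePDO

variable {n : ℕ}

/-! ### Difference operators indexed by words. -/

section Words

variable {G : Type*} [AddCommGroup G]

/-- The difference operator `Δ_{i₁} ⋯ Δ_{iₗ}` attached to a word `i₁ ⋯ iₗ`. -/
def wordDiff (L : List (Fin n)) (f : (Fin n → ℤ) → G) : (Fin n → ℤ) → G :=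
  L.foldr (fun i g => fwdDiff (Pi.single i (1 : ℤ)) g) f

@[simp] lemma wordDiff_nil (f : (Fin n → ℤ) → G) : wordDiff [] f = f := rfl

lemma wordDiff_cons (i : Fin n) (L : List (Fin n)) (f : (Fin n → ℤ) → G) :
    wordDiff (i :: L) f = fwdDiff (Pi.single i (1 : ℤ)) (wordDiff L f) := rfl

lemma fwdDiff_comm {A : Type*} [AddCommGroup A] (a b : A) (f : A → G) :
    fwdDiff a (fwdDiff b f) = fwdDiff b (fwdDiff a f) := by
  funext k
  simp only [fwdDiff, add_right_comm k a b]
  abel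

/-- Differences commute, so only the letter counts matter. Words allow induction one letter at a
time, and this lemma gives the passage to and from multi-indices. -/
lemma wordDiff_perm {L L' : List (Fin n)} (h : L.Perm L') (f : (Fin n → ℤ) → G) :
    wordDiff L f = wordDiff L' f :=
  h.foldr_eq' (f := fun i g => fwdDiff (Pi.single i (1 : ℤ)) g)
    (fun _ _ _ _ _ => fwdDiff_comm _ _ _) f

lemma wordDiff_append (L L' : List (Fin n)) (f : (Fin n → ℤ) → G) :
    wordDiff (L ++ L') f = wordDiff L (wordDiff L' f) := by
  simp [wordDiff, List.foldr_append]

lemma wordDiff_fwdDiff (L : List (Fin n)) (i : Fin n) (f : (Fin n → ℤ) → G) :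
    wordDiff L (fwdDiff (Pi.single i (1 : ℤ)) f) =
      fwdDiff (Pi.single i (1 : ℤ)) (wordDiff L f) := by
  rw [← wordDiff_cons, ← wordDiff_perm (List.perm_append_singleton i L), wordDiff_append]
  rfl

lemma wordDiff_add (L : List (Fin n)) (f g : (Fin n → ℤ) → G) :
    wordDiff L (f + g) = wordDiff L f + wordDiff L g := by
  induction L with
  | nil => rfl
  | cons i L ih => rw [wordDiff_cons, ih, fwdDiff_add]; rfl

lemma wordDiff_apply {ι : Type*} (L : List (Fin n)) (f : (Fin n → ℤ) → ι → G) (p : ι)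
    (k : Fin n → ℤ) : wordDiff L f k p = wordDiff L (fun k => f k p) k := by
  induction L generalizing k with
  | nil => rfl
  | cons i L ih => simp only [wordDiff_cons, fwdDiff, Pi.sub_apply, ih]

/-- The word `1^{α₁} ⋯ n^{αₙ}`. -/
def multiWord (α : Fin n → ℕ) : List (Fin n) :=
  (List.finRange n).flatMap fun j => List.replicate (α j) j

lemma wordDiff_replicate (i : Fin n) (m : ℕ) (f : (Fin n → ℤ) → G) :
    wordDiff (List.replicate m i) f = (fwdDiff (Pi.single i (1 : ℤ)))^[m] f := by
  induction m with
  | zero => rfl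
  | succ m ih => rw [List.replicate_succ, wordDiff_cons, ih, Function.iterate_succ_apply']

lemma latticeDiff_eq_wordDiff (α : Fin n → ℕ) (f : (Fin n → ℤ) → G) :
    latticeDiff α f = wordDiff (multiWord α) f := by
  unfold latticeDiff multiWord
  generalize List.finRange n = l
  induction l with
  | nil => rfl
  | cons i l ih => rw [List.foldr_cons, ih, List.flatMap_cons, wordDiff_append, wordDiff_replicate]

lemma count_multiWord (α : Fin n → ℕ) (i : Fin n) : (multiWord α).count i = α i := by
  simp only [multiWord, List.count_flatMap, Function.comp_def, List.count_replicate, beq_iff_eq]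
  rw [← List.ofFn_eq_map, List.sum_ofFn]
  simp

lemma length_multiWord (α : Fin n → ℕ) : (multiWord α).length = miLength α := by
  simp only [multiWord, List.length_flatMap, List.length_replicate, miLength]
  rw [← List.ofFn_eq_map, List.sum_ofFn]

lemma multiWord_perm {α : Fin n → ℕ} {L : List (Fin n)} (h : ∀ i, L.count i = α i) :
    (multiWord α).Perm L :=
  List.perm_iff_count.2 fun i => by rw [count_multiWord, h]

lemma wordDiff_eq_latticeDiff (L : List (Fin n)) (f : (Fin n → ℤ) → G) :
    wordDiff L f = latticeDiff (fun i => L.count i) f := by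
  rw [latticeDiff_eq_wordDiff, wordDiff_perm (multiWord_perm fun _ => rfl)]

lemma latticeDiff_add_single (α : Fin n → ℕ) (i : Fin n) (f : (Fin n → ℤ) → G) :
    latticeDiff (α + Pi.single i 1) f =
      latticeDiff α (fwdDiff (Pi.single i (1 : ℤ)) f) := by
  rw [latticeDiff_eq_wordDiff, latticeDiff_eq_wordDiff, wordDiff_fwdDiff, ← wordDiff_cons]
  refine wordDiff_perm (multiWord_perm fun j => ?_) f
  rw [List.count_cons, count_multiWord, Pi.add_apply, Pi.single_apply]
  by_cases h : j = i
  · simp [h]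
  · simp [h, Ne.symm h]

lemma latticeDiff_zero (f : (Fin n → ℤ) → G) :
    latticeDiff 0 f = f := by
  have h0 : multiWord (0 : Fin n → ℕ) = [] := by
    rw [← List.length_eq_zero_iff, length_multiWord]; simp [miLength]
  rw [latticeDiff_eq_wordDiff, h0, wordDiff_nil]

end Words

/-! ### The operators `k_i Δ_i`. -/

section Euler

variable {G : Type*} [AddCommGroup G] [Module ℂ G]

/-- The operator `k_i Δ_i`. -/
def euler (i : Fin n) (f : (Fin n → ℤ) → G) : (Fin n → ℤ) → G :=
  fun k => (k i : ℂ) • fwdDiff (Pi.single i (1 : ℤ)) f k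

/-- Only the letters `i` of `L` fail to commute with multiplication by `k_i`. With `q` of them, the
discrete Leibniz rule is `Δ_i^q (k_i g) = (k_i + q) Δ_i^q g + q Δ_i^{q-1} g`, used with `g = Δ_i f`.
-/
lemma wordDiff_euler (L : List (Fin n)) (i : Fin n) (f : (Fin n → ℤ) → G) (k : Fin n → ℤ) :
    wordDiff L (euler i f) k =
      ((k i : ℂ) + L.count i) • wordDiff (i :: L) f k + (L.count i : ℂ) • wordDiff L f k := by
  induction L generalizing k with
  | nil => simp [euler, wordDiff_cons]
  | cons j L ih =>
    have hc : wordDiff (i :: j :: L) f k =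
        wordDiff (i :: L) f (k + Pi.single j 1) - wordDiff (i :: L) f k := by
      rw [wordDiff_perm (List.Perm.swap j i L), wordDiff_cons j]; rfl
    rw [wordDiff_cons, fwdDiff, ih, ih, hc, wordDiff_cons j L f, fwdDiff]
    by_cases h : j = i
    · subst h
      simp only [wordDiff_cons j L f, fwdDiff, Pi.add_apply, Pi.single_eq_same,
        List.count_cons_self]
      push_cast
      module
    · have h' : i ≠ j := fun e => h e.symm
      simp only [Pi.add_apply, Pi.single_eq_of_ne h', List.count_cons_of_ne h]
      push_cast
      module

/-- The operator `∏_{i ∈ L} k_i Δ_i` for a word `L`. -/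
def eulerWord (L : List (Fin n)) (f : (Fin n → ℤ) → G) : (Fin n → ℤ) → G :=
  L.foldr euler f

/-- For `i ≠ j` the factor `k_j` is unaffected by `Δ_i`, so with distinct letters all factors can be
pulled out to the left. -/
lemma eulerWord_eq_of_nodup {L : List (Fin n)} (hL : L.Nodup) (f : (Fin n → ℤ) → G)
    (k : Fin n → ℤ) : eulerWord L f k = (L.map fun i => (k i : ℂ)).prod • wordDiff L f k := by
  induction L generalizing k with
  | nil => simp [eulerWord]
  | cons i L ih =>
    obtain ⟨hi, hL⟩ := List.nodup_cons.1 hL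
    have hm : (L.map fun j => (((k + Pi.single i 1 : Fin n → ℤ) j : ℤ) : ℂ)) =
        L.map fun j => (k j : ℂ) :=
      List.map_congr_left fun j hj => by
        rw [Pi.add_apply, Pi.single_eq_of_ne (fun e : j = i => hi (e ▸ hj)), add_zero]
    change euler i (eulerWord L f) k = _
    rw [euler, fwdDiff, ih hL, ih hL, hm, wordDiff_cons, fwdDiff, List.map_cons, List.prod_cons,
      mul_smul, ← smul_sub]

lemma nodup_multiWord {γ : Fin n → ℕ} (hγ : ∀ i, γ i ≤ 1) : (multiWord γ).Nodup :=
  List.nodup_iff_count_le_one.2 fun i => by rw [count_multiWord]; exact hγ i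

lemma prod_map_multiWord (γ : Fin n → ℕ) (w : Fin n → ℂ) :
    ((multiWord γ).map w).prod = ∏ i, w i ^ γ i := by
  rw [Finset.prod_list_map_count]
  simp only [count_multiWord]
  refine Finset.prod_subset (Finset.subset_univ _) fun i _ hi => ?_
  rw [List.mem_toFinset, ← List.count_pos_iff, count_multiWord, not_lt, Nat.le_zero] at hi
  rw [hi, pow_zero]

lemma pow_smul_latticeDiff_eq_eulerWord {γ : Fin n → ℕ} (hγ : ∀ i, γ i ≤ 1)
    (f : (Fin n → ℤ) → G) (k : Fin n → ℤ) :
    (∏ i, (k i : ℂ) ^ γ i) • latticeDiff γ f k = eulerWord (multiWord γ) f k := by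
  rw [eulerWord_eq_of_nodup (nodup_multiWord hγ), latticeDiff_eq_wordDiff, prod_map_multiWord]

end Euler

/-! ### A submultiplicative weight on the lattice and summation along lattice paths. -/

section Bracket

/-- The weight `1 + |j₁| + ⋯ + |jₙ|`. -/
def bracket (j : Fin n → ℤ) : ℝ := 1 + ∑ i, |(j i : ℝ)|

lemma one_le_bracket (j : Fin n → ℤ) : 1 ≤ bracket j :=
  le_add_of_nonneg_right (Finset.sum_nonneg fun _ _ => abs_nonneg _)

lemma bracket_pos (j : Fin n → ℤ) : 0 < bracket j := zero_lt_one.trans_le (one_le_bracket j)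

lemma bracket_neg (j : Fin n → ℤ) : bracket (-j) = bracket j := by simp [bracket]

lemma one_add_abs_le_bracket (j : Fin n → ℤ) (i : Fin n) : 1 + |(j i : ℝ)| ≤ bracket j :=
  add_le_add_right (Finset.single_le_sum (f := fun i => |(j i : ℝ)|)
    (fun _ _ => abs_nonneg _) (Finset.mem_univ i)) 1

lemma bracket_add_le (j l : Fin n → ℤ) : bracket (j + l) ≤ bracket j * bracket l := by
  have h : ∑ i, |((j + l) i : ℝ)| ≤ ∑ i, |(j i : ℝ)| + ∑ i, |(l i : ℝ)| := by
    rw [← Finset.sum_add_distrib]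
    refine Finset.sum_le_sum fun i _ => ?_
    rw [Pi.add_apply, Int.cast_add]
    exact abs_add_le _ _
  have h1 : 0 ≤ ∑ i, |(j i : ℝ)| := Finset.sum_nonneg fun _ _ => abs_nonneg _
  have h2 : 0 ≤ ∑ i, |(l i : ℝ)| := Finset.sum_nonneg fun _ _ => abs_nonneg _
  unfold bracket
  nlinarith [mul_nonneg h1 h2]

lemma abs_le_latticeNorm (k : Fin n → ℤ) (i : Fin n) : |(k i : ℝ)| ≤ latticeNorm k := by
  rw [← Real.sqrt_sq_eq_abs]
  exact Real.sqrt_le_sqrt (Finset.single_le_sum (f := fun i => (k i : ℝ) ^ 2)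
    (fun _ _ => sq_nonneg _) (Finset.mem_univ i))

lemma latticeNorm_nonneg (k : Fin n → ℤ) : 0 ≤ latticeNorm k := Real.sqrt_nonneg _

lemma one_add_latticeNorm_le (k : Fin n → ℤ) : 1 + latticeNorm k ≤ bracket k := by
  refine add_le_add_right (Real.sqrt_le_iff.2
    ⟨Finset.sum_nonneg fun _ _ => abs_nonneg _, ?_⟩) 1
  simp_rw [← sq_abs (( _ : ℤ) : ℝ)]
  exact Finset.sum_sq_le_sq_sum_of_nonneg fun _ _ => abs_nonneg _

lemma bracket_le (k : Fin n → ℤ) : bracket k ≤ (n + 1) * (1 + latticeNorm k) := by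
  have h : ∑ i, |(k i : ℝ)| ≤ n * latticeNorm k := by
    simpa using Finset.sum_le_card_nsmul Finset.univ _ _ fun i _ => abs_le_latticeNorm k i
  have := latticeNorm_nonneg k
  unfold bracket
  nlinarith [(Nat.cast_nonneg n : (0 : ℝ) ≤ n)]

lemma mem_latticeSchwartz_iff {f : (Fin n → ℤ) → ℂ} :
    f ∈ latticeSchwartz n ↔ ∀ M : ℕ, ∃ C : ℝ, ∀ k, ‖f k‖ * bracket k ^ M ≤ C := by
  refine forall_congr' fun M => ⟨fun ⟨C, hC⟩ => ⟨((n : ℝ) + 1) ^ M * C, fun k => ?_⟩,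
    fun ⟨C, hC⟩ => ⟨C, fun k => le_trans ?_ (hC k)⟩⟩
  · calc ‖f k‖ * bracket k ^ M
        ≤ ‖f k‖ * ((n + 1) * (1 + latticeNorm k)) ^ M := by
          gcongr
          · exact (bracket_pos k).le
          · exact bracket_le k
      _ = ((n : ℝ) + 1) ^ M * ((1 + latticeNorm k) ^ M * ‖f k‖) := by rw [mul_pow]; ring
      _ ≤ _ := by gcongr; exact hC k
  · rw [mul_comm]
    have := latticeNorm_nonneg k
    gcongr
    exact one_add_latticeNorm_le k

lemma summable_prod_apply {g : ℤ → ℝ} (hg : Summable g) (h0 : ∀ m, 0 ≤ g m) (n : ℕ) :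
    Summable fun j : Fin n → ℤ => ∏ i, g (j i) := by
  induction n with
  | zero => exact (hasSum_fintype _).summable
  | succ n ih =>
    rw [← (Fin.consEquiv fun _ => ℤ).summable_iff]
    refine (hg.mul_of_nonneg ih h0 fun _ => Finset.prod_nonneg fun _ _ => h0 _).congr fun p => ?_
    simp [Fin.consEquiv, Fin.prod_univ_succ]

lemma summable_inv_one_add_abs_sq : Summable fun m : ℤ => ((1 + |(m : ℝ)|) ^ 2)⁻¹ := by
  have h : Summable fun m : ℕ => ((1 + (m : ℝ)) ^ 2)⁻¹ := by
    have := (summable_nat_add_iff 1).2 (Real.summable_nat_pow_inv.2 one_lt_two)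
    refine this.congr fun m => ?_
    push_cast
    rw [add_comm]
  exact Summable.of_nat_of_neg (by simpa using h) (by simpa using h)

/-- The power `2 * n` dominates the product of the `n` summable one-dimensional weights `(1 +
|j_i|)^2`. This exponent is the price of every summation over the lattice below. -/
lemma summable_inv_bracket_pow (n : ℕ) :
    Summable fun j : Fin n → ℤ => (bracket j ^ (2 * n))⁻¹ := by
  refine Summable.of_nonneg_of_le (fun j => inv_nonneg.2 (pow_nonneg (bracket_pos j).le _))
    (fun j => ?_) (summable_prod_apply summable_inv_one_add_abs_sq (fun m => by positivity) n)
  rw [Finset.prod_inv_distrib]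
  refine inv_anti₀ (Finset.prod_pos fun i _ => by positivity) ?_
  calc ∏ i, (1 + |(j i : ℝ)|) ^ 2 ≤ ∏ _i : Fin n, bracket j ^ 2 := by
        refine Finset.prod_le_prod (fun _ _ => by positivity) fun i _ => ?_
        gcongr
        exact one_add_abs_le_bracket j i
    _ = bracket j ^ (2 * n) := by simp [pow_mul]

/-- One unit step towards the origin along a nonzero coordinate. The final alternative records its
sign, because only forward differences are controlled in the application. -/
lemma exists_natAbs_pred {j : Fin n → ℤ} {m : ℕ} (h : ∑ i, (j i).natAbs = m + 1) :
    ∃ (i : Fin n) (l : Fin n → ℤ), ∑ i, (l i).natAbs = m ∧ bracket l ≤ bracket j ∧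
      (j = l + Pi.single i 1 ∨ l = j + Pi.single i 1) := by
  obtain ⟨i, hi⟩ : ∃ i, j i ≠ 0 := by
    by_contra! h0
    simp [h0] at h
  have key : ∀ z : ℤ, (j i + z).natAbs + 1 = (j i).natAbs →
      ∑ a, ((j + Pi.single i z : Fin n → ℤ) a).natAbs = m ∧
        bracket (j + Pi.single i z : Fin n → ℤ) ≤ bracket j := by
    intro z hz
    have hle : ∀ a, ((j + Pi.single i z : Fin n → ℤ) a).natAbs ≤ (j a).natAbs := fun a => by
      by_cases ha : a = i
      · subst ha; simp only [Pi.add_apply, Pi.single_eq_same]; omega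
      · simp [ha]
    refine ⟨?_, ?_⟩
    · have e1 := Finset.add_sum_erase Finset.univ (fun a => (j a).natAbs) (Finset.mem_univ i)
      have e2 := Finset.add_sum_erase Finset.univ
        (fun a => ((j + Pi.single i z : Fin n → ℤ) a).natAbs) (Finset.mem_univ i)
      have e3 : ∑ a ∈ Finset.univ.erase i, ((j + Pi.single i z : Fin n → ℤ) a).natAbs =
          ∑ a ∈ Finset.univ.erase i, (j a).natAbs :=
        Finset.sum_congr rfl fun a ha => by simp [Finset.ne_of_mem_erase ha]
      simp only [Pi.add_apply, Pi.single_eq_same] at e1 e2 e3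
      simp only [Pi.add_apply]
      omega
    · refine add_le_add_right (Finset.sum_le_sum fun a _ => ?_) 1
      rw [← Int.cast_abs, ← Int.cast_abs, Int.cast_le, Int.abs_eq_natAbs, Int.abs_eq_natAbs]
      exact_mod_cast hle a
  rcases lt_or_gt_of_ne hi with hneg | hpos
  · obtain ⟨h1, h2⟩ := key 1 (by omega)
    exact ⟨i, _, h1, h2, Or.inr rfl⟩
  · obtain ⟨h1, h2⟩ := key (-1) (by omega)
    refine ⟨i, _, h1, h2, Or.inl ?_⟩
    rw [add_assoc, ← Pi.single_add]
    simp

/-- A function on the lattice whose first differences grow polynomially grows polynomially. -/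
lemma norm_sub_zero_le_of_fwdDiff_le {E : Type*} [NormedAddCommGroup E] {f : (Fin n → ℤ) → E}
    {B : ℝ} (hB : 0 ≤ B) {K : ℕ}
    (hf : ∀ j i, ‖f (j + Pi.single i 1) - f j‖ ≤ B * bracket j ^ K) (j : Fin n → ℤ) :
    ‖f j - f 0‖ ≤ B * bracket j ^ (K + 1) := by
  have key : ∀ m : ℕ, ∀ j : Fin n → ℤ, ∑ i, (j i).natAbs = m →
      ‖f j - f 0‖ ≤ m * (B * bracket j ^ K) := by
    intro m
    induction m with
    | zero =>
      intro j hj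
      have : j = 0 := funext fun i => by
        simpa using Finset.sum_eq_zero_iff.1 hj i (Finset.mem_univ i)
      simp [this]
    | succ m ih =>
      intro j hj
      obtain ⟨i, l, hl, hle, h⟩ := exists_natAbs_pred hj
      have hpow : B * bracket l ^ K ≤ B * bracket j ^ K := by
        gcongr
        exact (bracket_pos l).le
      have hstep : ‖f j - f l‖ ≤ B * bracket j ^ K := by
        rcases h with rfl | rfl
        · exact (hf l i).trans hpow
        · rw [norm_sub_rev]; exact hf j i
      calc ‖f j - f 0‖ ≤ ‖f j - f l‖ + ‖f l - f 0‖ := norm_sub_le_norm_sub_add_norm_sub _ _ _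
        _ ≤ B * bracket j ^ K + m * (B * bracket j ^ K) := by
          refine add_le_add hstep ((ih l hl).trans ?_)
          gcongr
        _ = _ := by push_cast; ring
  have hm : ((∑ i, (j i).natAbs : ℕ) : ℝ) ≤ bracket j := by
    rw [bracket, Nat.cast_sum]
    simp only [Nat.cast_natAbs, Int.cast_abs]
    linarith
  calc ‖f j - f 0‖ ≤ _ := key _ j rfl
    _ ≤ bracket j * (B * bracket j ^ K) := by
      have := (bracket_pos j).le
      gcongr
    _ = _ := by ring

end Bracket

/-! ### Temperate weights; powers of a weight function are temperate. -/

section Temperate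

/-- A positive function on the lattice is temperate if translation by `j` changes it at most by a
factor of polynomial growth in `j`. -/
def IsTemperate (w : (Fin n → ℤ) → ℝ) : Prop :=
  (∀ k, 0 < w k) ∧ ∃ (C : ℝ) (K : ℕ), 0 ≤ C ∧ ∀ k j, w (k + j) ≤ C * bracket j ^ K * w k

lemma IsTemperate.mul {v w : (Fin n → ℤ) → ℝ} (hv : IsTemperate v) (hw : IsTemperate w) :
    IsTemperate fun k => v k * w k := by
  obtain ⟨hv0, C, K, hC, hv⟩ := hv
  obtain ⟨hw0, D, L, hD, hw⟩ := hw
  refine ⟨fun k => mul_pos (hv0 k) (hw0 k), C * D, K + L, mul_nonneg hC hD, fun k j => ?_⟩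
  calc v (k + j) * w (k + j) ≤ (C * bracket j ^ K * v k) * (D * bracket j ^ L * w k) :=
        mul_le_mul (hv k j) (hw k j) (hw0 _).le ((hv0 _).le.trans (hv k j))
    _ = _ := by ring

lemma IsTemperate.inv {w : (Fin n → ℤ) → ℝ} (hw : IsTemperate w) :
    IsTemperate fun k => (w k)⁻¹ := by
  obtain ⟨hw0, C, K, hC, hw⟩ := hw
  refine ⟨fun k => inv_pos.2 (hw0 k), C, K, hC, fun k j => ?_⟩
  -- Translating back from `k + j` to `k` gives the lower bound on `w (k + j)` that the inverse
  -- needs.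
  have h := hw (k + j) (-j)
  rw [add_neg_cancel_right, bracket_neg] at h
  rw [inv_le_iff_one_le_mul₀ (hw0 _), mul_right_comm, ← div_eq_mul_inv, one_le_div (hw0 k)]
  exact h

lemma IsTemperate.rpow_of_nonneg {w : (Fin n → ℤ) → ℝ} (hw : IsTemperate w) {s : ℝ}
    (hs : 0 ≤ s) : IsTemperate fun k => w k ^ s := by
  obtain ⟨hw0, C, K, hC, hw⟩ := hw
  refine ⟨fun k => Real.rpow_pos_of_pos (hw0 k) s, C ^ s, ⌈K * s⌉₊, Real.rpow_nonneg hC s,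
    fun k j => ?_⟩
  have hb := one_le_bracket j
  have hb0 := (bracket_pos j).le
  calc w (k + j) ^ s ≤ (C * bracket j ^ K * w k) ^ s :=
        Real.rpow_le_rpow (hw0 _).le (hw k j) hs
    _ = C ^ s * bracket j ^ (K * s) * w k ^ s := by
        rw [Real.mul_rpow (by positivity) (hw0 k).le, Real.mul_rpow hC (by positivity),
          ← Real.rpow_natCast, ← Real.rpow_mul hb0]
    _ ≤ C ^ s * bracket j ^ ⌈K * s⌉₊ * w k ^ s := by
        have := Real.rpow_nonneg (hw0 k).le s
        have := Real.rpow_nonneg hC s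
        rw [← Real.rpow_natCast (bracket j) ⌈K * s⌉₊]
        gcongr
        exact Nat.le_ceil _

lemma IsTemperate.rpow {w : (Fin n → ℤ) → ℝ} (hw : IsTemperate w) (s : ℝ) :
    IsTemperate fun k => w k ^ s := by
  rcases le_total 0 s with hs | hs
  · exact hw.rpow_of_nonneg hs
  · have := (hw.rpow_of_nonneg (neg_nonneg.2 hs)).inv
    simpa only [Real.rpow_neg (hw.1 _).le, inv_inv] using this

lemma isTemperate_one_add_abs (i : Fin n) : IsTemperate fun k : Fin n → ℤ => 1 + |(k i : ℝ)| := by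
  refine ⟨fun k => by positivity, 1, 1, zero_le_one, fun k j => ?_⟩
  have h1 := one_add_abs_le_bracket j i
  have h2 : |(k i : ℝ) + j i| ≤ _ := abs_add_le _ _
  have h3 := abs_nonneg (k i : ℝ)
  have h4 := abs_nonneg (j i : ℝ)
  simp only [Pi.add_apply, Int.cast_add, one_mul, pow_one]
  nlinarith

lemma IsWeight.exists_pos_le {μ : ℝ} {Λ : (Fin n → ℤ) → ℝ} (h : IsWeight μ Λ) :
    ∃ δ : ℝ, 0 < δ ∧ ∀ k, δ ≤ Λ k := by
  obtain ⟨⟨μ₀, _, C₀, _, h0, -, -, hC₀, -, h⟩, -⟩ := h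
  refine ⟨C₀, hC₀, fun k => le_trans ?_ (h k).1⟩
  have := Real.one_le_rpow (le_add_of_nonneg_right (latticeNorm_nonneg k)) h0.le
  exact le_mul_of_one_le_right hC₀.le this

lemma IsWeight.pos {μ : ℝ} {Λ : (Fin n → ℤ) → ℝ} (h : IsWeight μ Λ) (k : Fin n → ℤ) : 0 < Λ k :=
  let ⟨_, hδ, hle⟩ := h.exists_pos_le
  hδ.trans_le (hle k)

lemma IsWeight.parameter_pos {μ : ℝ} {Λ : (Fin n → ℤ) → ℝ} (h : IsWeight μ Λ) : 0 < μ :=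
  let ⟨⟨_, _, _, _, h0, h1, h2, _⟩, _⟩ := h
  h0.trans_le (h1.trans h2)

lemma IsWeight.abs_sub_le {μ : ℝ} {Λ : (Fin n → ℤ) → ℝ} (h : IsWeight μ Λ) :
    ∃ c : ℝ, 0 < c ∧ ∀ k i, |Λ (k + Pi.single i 1) - Λ k| ≤ c * Λ k ^ (1 - 1 / μ) := by
  choose C hC0 hC using fun i : Fin n => h.2 (Pi.single i 1) 0 fun _ => zero_le_one
  have hsum : 0 ≤ ∑ i, C i := Finset.sum_nonneg fun i _ => (hC0 i).le
  -- The sum makes the constant uniform in `i`; the `1` keeps it positive when `n = 0`.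
  refine ⟨1 + ∑ i, C i, by linarith, fun k i => ?_⟩
  have h1 := hC i k
  have e : latticeDiff (Pi.single i 1 + 0) Λ = fwdDiff (Pi.single i (1 : ℤ)) Λ := by
    have := latticeDiff_add_single 0 i Λ
    rw [zero_add] at this
    rw [add_zero, this, latticeDiff_zero]
  have e2 : miLength (Pi.single i 1 : Fin n → ℕ) = 1 := by simp [miLength]
  rw [e, e2] at h1
  simp only [Pi.zero_apply, pow_zero, Finset.prod_const_one, one_mul, Nat.cast_one, mul_one,
    fwdDiff] at h1
  refine h1.trans ?_
  have := Real.rpow_nonneg (h.pos k).le (1 - 1 / μ)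
  gcongr
  have := Finset.single_le_sum (fun i _ => (hC0 i).le) (Finset.mem_univ i)
  linarith

/-- A linear bound on a bounded range, valid for every exponent `p > 0`: combine `(1 + z)^p ≤
e^{pz}` with `e^u ≤ 1 + u e^u`. -/
lemma one_add_rpow_le {p z Z : ℝ} (hp : 0 < p) (hz : 0 ≤ z) (hZ : z ≤ Z) :
    (1 + z) ^ p ≤ 1 + p * Real.exp (p * Z) * z := by
  have h1 : (1 + z) ^ p ≤ Real.exp (p * z) := by
    rw [mul_comm, Real.exp_mul]
    exact Real.rpow_le_rpow (by positivity) (by linarith [Real.add_one_le_exp z]) hp.le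
  have h2 : Real.exp (p * z) ≤ 1 + p * z * Real.exp (p * z) := by
    have h3 := Real.one_sub_le_exp_neg (p * z)
    have h4 : Real.exp (-(p * z)) * Real.exp (p * z) = 1 := by rw [← Real.exp_add]; simp
    nlinarith [Real.exp_pos (p * z)]
  have h5 : Real.exp (p * z) ≤ Real.exp (p * Z) := Real.exp_le_exp.2 (by gcongr)
  have h6 : p * z * Real.exp (p * z) ≤ p * z * Real.exp (p * Z) := by gcongr
  linarith

/-- The derivative of `x^p` is `p x^{p-1}`, so an increment of size `x^{1-p}` changes `x^p` by a
bounded amount. In terms of the relative increment `z = c x^{-p}`, the product `x^p z = c` is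
constant. -/
lemma abs_rpow_sub_rpow_le {p c δ : ℝ} (hp : 0 < p) (hc : 0 < c) (hδ : 0 < δ) :
    ∃ D : ℝ, 0 ≤ D ∧ ∀ x y : ℝ, δ ≤ x → δ ≤ y → |y - x| ≤ c * x ^ (1 - p) →
      |y ^ p - x ^ p| ≤ D := by
  set Z := c * (δ ^ p)⁻¹ with hZ
  set D₁ := p * Real.exp (p * Z) * c
  set D₂ := p * Real.exp (p * 1) * (2 * c) * (1 + Z) ^ p
  have hZ0 : 0 ≤ Z := by positivity
  refine ⟨D₁ + D₂ + 2 * c, by positivity, fun x y hx hy h => ?_⟩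
  have hx0 := hδ.trans_le hx
  have hy0 := hδ.trans_le hy
  have hxp : 0 < x ^ p := Real.rpow_pos_of_pos hx0 p
  have hyp : 0 < y ^ p := Real.rpow_pos_of_pos hy0 p
  have hz : c * x ^ (1 - p) = x * (c * (x ^ p)⁻¹) := by
    rw [Real.rpow_sub hx0, Real.rpow_one]; field_simp
  set z := c * (x ^ p)⁻¹
  have hz0 : 0 ≤ z := by positivity
  have hzx : x ^ p * z = c := by simp only [z]; field_simp
  have hzZ : z ≤ Z := by
    have : δ ^ p ≤ x ^ p := Real.rpow_le_rpow hδ.le hx hp.le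
    simp only [z, Z]
    gcongr
  rw [hz, abs_le] at h
  have hyx : y ≤ x * (1 + z) := by linarith
  have hupper : y ^ p ≤ x ^ p * (1 + z) ^ p := by
    rw [← Real.mul_rpow hx0.le (by positivity)]
    exact Real.rpow_le_rpow hy0.le hyx hp.le
  have h1 : y ^ p ≤ x ^ p + D₁ := by
    calc y ^ p ≤ x ^ p * (1 + z) ^ p := hupper
      _ ≤ x ^ p * (1 + p * Real.exp (p * Z) * z) := by
          gcongr; exact one_add_rpow_le hp hz0 hzZ
      _ = x ^ p + p * Real.exp (p * Z) * (x ^ p * z) := by ring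
      _ = _ := by rw [hzx]
  have h2 : x ^ p ≤ y ^ p + (D₂ + 2 * c) := by
    have hD2 : 0 ≤ D₂ := by positivity
    -- For `z ≤ 1/2`, `(1 - z)(1 + 2z) ≥ 1` turns `y ≥ x(1 - z)` into `x ≤ y(1 + 2z)`. For `z ≥
    -- 1/2`, `x^p = c / z ≤ 2c` already.
    rcases le_total z (1 / 2) with hle | hge
    · have hxy : x ≤ y * (1 + 2 * z) := by nlinarith
      calc x ^ p ≤ y ^ p * (1 + 2 * z) ^ p := by
            rw [← Real.mul_rpow hy0.le (by positivity)]
            exact Real.rpow_le_rpow hx0.le hxy hp.le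
        _ ≤ y ^ p * (1 + p * Real.exp (p * 1) * (2 * z)) := by
            gcongr; exact one_add_rpow_le hp (by positivity) (by linarith)
        _ = y ^ p + p * Real.exp (p * 1) * (2 * z) * y ^ p := by ring
        _ ≤ y ^ p + p * Real.exp (p * 1) * (2 * z) * (x ^ p * (1 + Z) ^ p) := by
            gcongr
            refine hupper.trans ?_
            gcongr
        _ = y ^ p + p * Real.exp (p * 1) * (2 * (x ^ p * z)) * (1 + Z) ^ p := by ring
        _ = y ^ p + D₂ := by rw [hzx]
        _ ≤ _ := by linarith
    · nlinarith
  have : 0 ≤ D₁ := by positivity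
  have : 0 ≤ D₂ := by positivity
  rw [abs_le]
  constructor <;> linarith

/-- Every real power of a weight function is temperate. -/
lemma IsWeight.isTemperate_rpow {μ : ℝ} {Λ : (Fin n → ℤ) → ℝ} (h : IsWeight μ Λ) (s : ℝ) :
    IsTemperate fun k => Λ k ^ s := by
  have hμ := h.parameter_pos
  have hp : 0 < 1 / μ := by positivity
  obtain ⟨δ, hδ, hle⟩ := h.exists_pos_le
  obtain ⟨c, hc, hdiff⟩ := h.abs_sub_le
  obtain ⟨D, hD, hDle⟩ := abs_rpow_sub_rpow_le hp hc hδ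
  -- The weight condition of order one matches `abs_rpow_sub_rpow_le` with `p = 1 / μ`, so `Λ^{1/μ}`
  -- has bounded differences and grows at most linearly along a path from `k` to `k + j`. The
  -- positive lower bound of `Λ` turns this additive bound into a multiplicative one.
  have hφ : IsTemperate fun k => Λ k ^ (1 / μ) := by
    have hδp : 0 < δ ^ (1 / μ) := Real.rpow_pos_of_pos hδ _
    refine ⟨fun k => Real.rpow_pos_of_pos (h.pos k) _, 1 + D / δ ^ (1 / μ), 1, by positivity,
      fun k j => ?_⟩
    have hpath := norm_sub_zero_le_of_fwdDiff_le (f := fun j => Λ (k + j) ^ (1 / μ)) hD (K := 0)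
      (fun j i => by
        rw [pow_zero, mul_one, Real.norm_eq_abs, ← add_assoc]
        exact hDle _ _ (hle _) (hle _) (hdiff _ _)) j
    simp only [add_zero, zero_add, pow_one, Real.norm_eq_abs] at hpath
    have h1 := (le_abs_self _).trans hpath
    have h2 : δ ^ (1 / μ) ≤ Λ k ^ (1 / μ) := Real.rpow_le_rpow hδ.le (hle k) hp.le
    have h3 : D * bracket j ≤ D / δ ^ (1 / μ) * bracket j * Λ k ^ (1 / μ) := by
      have := bracket_pos j
      calc D * bracket j = D / δ ^ (1 / μ) * bracket j * δ ^ (1 / μ) := by field_simp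
        _ ≤ _ := by gcongr
    have h4 : Λ k ^ (1 / μ) ≤ bracket j * Λ k ^ (1 / μ) :=
      le_mul_of_one_le_left (hδp.le.trans h2) (one_le_bracket j)
    rw [pow_one]
    linarith
  have := hφ.rpow (μ * s)
  simp only [← Real.rpow_mul (h.pos _).le] at this
  convert this using 3
  field_simp

end Temperate

/-! ### The discrete Taylor (Newton) expansion and its remainder. -/

section Taylor

/-- The falling factorial `z (z - 1) ⋯ (z - l + 1)`. -/
def falling (z : ℂ) : ℕ → ℂ
  | 0 => 1
  | l + 1 => (z - l) * falling z l

lemma falling_succ (z : ℂ) (l : ℕ) : falling z (l + 1) = (z - l) * falling z l := rfl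

lemma falling_add_one (z : ℂ) (l : ℕ) :
    falling (z + 1) (l + 1) = falling z (l + 1) + (l + 1) * falling z l := by
  induction l with
  | zero => simp [falling]
  | succ l ih =>
    rw [falling_succ (z + 1) (l + 1), ih, falling_succ z (l + 1), falling_succ z l]
    push_cast
    ring

/-- The multivariate falling factorial `j^{(α)}`. -/
def miFalling (j : Fin n → ℤ) (α : Fin n → ℕ) : ℂ := ∏ i, falling (j i) (α i)

/-- The multivariate binomial coefficient `j^{(α)} / α!`. -/
def miBinom (j : Fin n → ℤ) (α : Fin n → ℕ) : ℂ :=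
  ∏ i, falling (j i) (α i) / ((α i).factorial : ℂ)

lemma miBinom_eq (j : Fin n → ℤ) (α : Fin n → ℕ) :
    miBinom j α = 1 / (miFactorial α : ℂ) * miFalling j α := by
  rw [miBinom, miFalling, miFactorial, Finset.prod_div_distrib, Nat.cast_prod]
  ring

lemma miBinom_zero_right (j : Fin n → ℤ) : miBinom j 0 = 1 := by simp [miBinom, falling]

lemma falling_zero_succ (l : ℕ) : falling 0 (l + 1) = 0 := by
  induction l with
  | zero => simp [falling]
  | succ l ih => rw [falling_succ, ih, mul_zero]

lemma miBinom_zero_left {α : Fin n → ℕ} (hα : α ≠ 0) : miBinom 0 α = 0 := by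
  obtain ⟨i, hi⟩ := Function.ne_iff.1 hα
  obtain ⟨l, hl⟩ := Nat.exists_eq_succ_of_ne_zero hi
  refine Finset.prod_eq_zero (Finset.mem_univ i) ?_
  rw [hl, Pi.zero_apply, Int.cast_zero, falling_zero_succ, zero_div]

lemma miBinom_split (j : Fin n → ℤ) (α : Fin n → ℕ) (i : Fin n) :
    miBinom j α = falling (j i) (α i) / ((α i).factorial : ℂ) *
      ∏ a ∈ Finset.univ.erase i, falling (j a) (α a) / ((α a).factorial : ℂ) :=
  (Finset.mul_prod_erase _ _ (Finset.mem_univ i)).symm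

lemma miBinom_add_single_left {j : Fin n → ℤ} {α : Fin n → ℕ} {i : Fin n} (h : α i = 0) :
    miBinom (j + Pi.single i 1) α = miBinom j α := by
  rw [miBinom_split _ _ i, miBinom_split j α i, h]
  congr 1
  refine Finset.prod_congr rfl fun a ha => ?_
  simp [Finset.ne_of_mem_erase ha]

lemma miBinom_pascal (j : Fin n → ℤ) (α : Fin n → ℕ) (i : Fin n) :
    miBinom (j + Pi.single i 1) (α + Pi.single i 1) =
      miBinom j (α + Pi.single i 1) + miBinom j α := by
  have e : ∏ a ∈ Finset.univ.erase i, falling ((j + Pi.single i 1 : Fin n → ℤ) a)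
        ((α + Pi.single i 1 : Fin n → ℕ) a) / (((α + Pi.single i 1 : Fin n → ℕ) a).factorial : ℂ) =
      ∏ a ∈ Finset.univ.erase i, falling (j a) (α a) / ((α a).factorial : ℂ) :=
    Finset.prod_congr rfl fun a ha => by simp [Finset.ne_of_mem_erase ha]
  have e' : ∏ a ∈ Finset.univ.erase i, falling (j a)
        ((α + Pi.single i 1 : Fin n → ℕ) a) / (((α + Pi.single i 1 : Fin n → ℕ) a).factorial : ℂ) =
      ∏ a ∈ Finset.univ.erase i, falling (j a) (α a) / ((α a).factorial : ℂ) :=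
    Finset.prod_congr rfl fun a ha => by simp [Finset.ne_of_mem_erase ha]
  rw [miBinom_split _ _ i, miBinom_split j _ i, miBinom_split j α i, e, e', ← add_mul]
  congr 1
  simp only [Pi.add_apply, Pi.single_eq_same, Int.cast_add, Int.cast_one, falling_add_one,
    Nat.factorial_succ, Nat.cast_mul, Nat.cast_add, Nat.cast_one]
  have h1 : ((α i : ℂ) + 1) ≠ 0 := Nat.cast_add_one_ne_zero _
  have h2 : ((α i).factorial : ℂ) ≠ 0 := Nat.cast_ne_zero.2 (Nat.factorial_ne_zero _)
  field_simp

/-- The homogeneous part of degree `d` of the discrete Taylor expansion of `v (k + j)`. -/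
def taylorTerm (d : ℕ) (j : Fin n → ℤ) (v : (Fin n → ℤ) → ℂ) (k : Fin n → ℤ) : ℂ :=
  ∑ α ∈ (Finset.univ : Finset (Fin n)).piAntidiag d, miBinom j α * latticeDiff α v k

/-- The remainder of order `N` of the discrete Taylor expansion of `v (k + j)`. -/
def taylorRem (N : ℕ) (j : Fin n → ℤ) (v : (Fin n → ℤ) → ℂ) (k : Fin n → ℤ) : ℂ :=
  v (k + j) - ∑ d ∈ Finset.range N, taylorTerm d j v k

lemma taylorTerm_zero (j : Fin n → ℤ) (v : (Fin n → ℤ) → ℂ) (k : Fin n → ℤ) :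
    taylorTerm 0 j v k = v k := by
  simp [taylorTerm, miBinom_zero_right, latticeDiff_zero]

/-- Pascal's rule summed over `|α| = d + 1`: indices with `α_i = 0` do not see the shift, and the
others are `β + e_i` with `|β| = d`. -/
lemma taylorTerm_succ_add_single (d : ℕ) (j : Fin n → ℤ) (i : Fin n) (v : (Fin n → ℤ) → ℂ)
    (k : Fin n → ℤ) : taylorTerm (d + 1) (j + Pi.single i 1) v k =
      taylorTerm (d + 1) j v k + taylorTerm d j (fwdDiff (Pi.single i (1 : ℤ)) v) k := by
  rw [← sub_eq_iff_eq_add']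
  unfold taylorTerm
  rw [← Finset.sum_sub_distrib]
  symm
  refine Finset.sum_of_injOn (fun β => β + Pi.single i 1) (fun _ _ _ _ h => add_right_cancel h)
    (fun β hβ => ?_) (fun α hα h => ?_) fun β _ => ?_
  · simp only [Finset.mem_coe, Finset.mem_piAntidiag, Finset.mem_univ, implies_true,
      and_true] at hβ ⊢
    simp [Finset.sum_add_distrib, hβ]
  · rw [← sub_mul, miBinom_add_single_left, sub_self, zero_mul]
    by_contra hi
    refine h ⟨α - Pi.single i 1, ?_, ?_⟩
    · simp only [Finset.mem_coe, Finset.mem_piAntidiag, Finset.mem_univ, implies_true,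
        and_true] at hα ⊢
      have e : α = (α - Pi.single i 1) + Pi.single i 1 := funext fun a => by
        by_cases ha : a = i
        · subst ha; simp; omega
        · simp [ha]
      rw [e] at hα
      simpa [Finset.sum_add_distrib] using hα
    · funext a
      by_cases ha : a = i
      · subst ha; simp; omega
      · simp [ha]
  · rw [miBinom_pascal, latticeDiff_add_single]
    ring

lemma taylorTerm_succ_zero (d : ℕ) (v : (Fin n → ℤ) → ℂ) (k : Fin n → ℤ) :
    taylorTerm (d + 1) 0 v k = 0 := by
  refine Finset.sum_eq_zero fun α hα => ?_
  rw [miBinom_zero_left, zero_mul]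
  rintro rfl
  simp at hα

/-- The difference in `j` of a remainder is a remainder of one order less, taken of `Δ_i v`.
Together with vanishing at `j = 0`, this replaces an integral formula for the remainder. -/
lemma taylorRem_succ_add_single (N : ℕ) (j : Fin n → ℤ) (i : Fin n) (v : (Fin n → ℤ) → ℂ)
    (k : Fin n → ℤ) : taylorRem (N + 1) (j + Pi.single i 1) v k =
      taylorRem (N + 1) j v k + taylorRem N j (fwdDiff (Pi.single i (1 : ℤ)) v) k := by
  simp only [taylorRem, Finset.sum_range_succ', taylorTerm_zero, taylorTerm_succ_add_single,
    Finset.sum_add_distrib, fwdDiff, add_assoc]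
  ring

lemma taylorRem_succ_zero (N : ℕ) (v : (Fin n → ℤ) → ℂ) (k : Fin n → ℤ) :
    taylorRem (N + 1) 0 v k = 0 := by
  simp [taylorRem, Finset.sum_range_succ', taylorTerm_zero, taylorTerm_succ_zero]

lemma latticeDiff_fwdDiff {G : Type*} [AddCommGroup G] (α : Fin n → ℕ) (i : Fin n)
    (v : (Fin n → ℤ) → G) : latticeDiff α (fwdDiff (Pi.single i (1 : ℤ)) v) =
      fwdDiff (Pi.single i (1 : ℤ)) (latticeDiff α v) := by
  rw [latticeDiff_eq_wordDiff, latticeDiff_eq_wordDiff, wordDiff_fwdDiff]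

lemma taylorRem_wordDiff (N : ℕ) (j : Fin n → ℤ) (L : List (Fin n)) (v : (Fin n → ℤ) → ℂ) :
    taylorRem N j (wordDiff L v) = wordDiff L (taylorRem N j v) := by
  induction L with
  | nil => rfl
  | cons i L ih =>
    rw [wordDiff_cons, wordDiff_cons, ← ih]
    funext k
    simp only [taylorRem, taylorTerm, latticeDiff_fwdDiff, fwdDiff, mul_sub,
      Finset.sum_sub_distrib, add_right_comm]
    ring

/-- The remainder of order `N` is controlled by the differences of order `N`. -/
lemma exists_taylorRem_le (N : ℕ) {w : (Fin n → ℤ) → ℝ} (hw : IsTemperate w) :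
    ∃ (C : ℝ) (K : ℕ), 0 ≤ C ∧ ∀ (v : (Fin n → ℤ) → ℂ) (A : ℝ), 0 ≤ A →
      (∀ L : List (Fin n), L.length = N → ∀ k, ‖wordDiff L v k‖ ≤ A * w k) →
      ∀ j k, ‖taylorRem N j v k‖ ≤ C * bracket j ^ K * (A * w k) := by
  induction N with
  | zero =>
    obtain ⟨-, C, K, hC, hw⟩ := hw
    refine ⟨C, K, hC, fun v A hA hv j k => ?_⟩
    have := hv [] rfl (k + j)
    simp only [wordDiff_nil] at this
    simp only [taylorRem, Finset.range_zero, Finset.sum_empty, sub_zero]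
    calc ‖v (k + j)‖ ≤ A * w (k + j) := this
      _ ≤ A * (C * bracket j ^ K * w k) := by gcongr; exact hw k j
      _ = _ := by ring
  | succ N ih =>
    obtain ⟨C, K, hC, ih⟩ := ih
    refine ⟨C, K + 1, hC, fun v A hA hv j k => ?_⟩
    have hwk := (hw.1 k).le
    -- The remainder is summed along a path from `j = 0`, where it vanishes; the increments are
    -- remainders of order `N`, and the path length costs one more power of the bracket.
    have := norm_sub_zero_le_of_fwdDiff_le (f := fun j => taylorRem (N + 1) j v k)
      (B := C * (A * w k)) (by positivity) (K := K) (fun j i => ?_) j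
    · simp only [taylorRem_succ_zero, sub_zero] at this
      linarith
    · rw [taylorRem_succ_add_single, add_sub_cancel_left]
      have := ih (fwdDiff (Pi.single i (1 : ℤ)) v) A hA (fun L hL k => by
        rw [wordDiff_fwdDiff, ← wordDiff_cons]
        exact hv (i :: L) (by simp [hL]) k) j k
      linarith

end Taylor

/-! ### Coefficient families, the Leibniz estimate and the composition estimate. -/

section CoefClass

/-- The weight of a letter: a marked letter `i` weighs `1 + |k_i|`, an unmarked one `θ k`. -/
def letterWeight (θ : (Fin n → ℤ) → ℝ) (k : Fin n → ℤ) (l : Fin n × Bool) : ℝ :=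
  if l.2 then 1 + |(k l.1 : ℝ)| else θ k

/-- The weight of a word of marked and unmarked letters. -/
def wordWeight (θ : (Fin n → ℤ) → ℝ) (W : List (Fin n × Bool)) (k : Fin n → ℤ) : ℝ :=
  (W.map (letterWeight θ k)).prod

/-- The marked letters of a word. -/
def markedLetters (W : List (Fin n × Bool)) : List (Fin n) := (W.filter (·.2)).map Prod.fst

/-- Families of coefficients `a k j`, rapidly decreasing in `j`, whose differences in `k` obey the
symbol estimates of order `w`; differences in distinct marked directions `i` gain `1 + |k_i|` and
those in unmarked directions gain `θ`. -/
def coefClass (θ w : (Fin n → ℤ) → ℝ) : Set ((Fin n → ℤ) → (Fin n → ℤ) → ℂ) :=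
  {a | ∀ W : List (Fin n × Bool), (markedLetters W).Nodup → ∀ M : ℕ, ∃ C : ℝ, 0 ≤ C ∧
    ∀ k j, ‖wordDiff (W.map Prod.fst) a k j‖ * wordWeight θ W k * bracket j ^ M ≤ C * w k}

lemma letterWeight_pos {θ : (Fin n → ℤ) → ℝ} (hθ : ∀ k, 0 < θ k) (k : Fin n → ℤ)
    (l : Fin n × Bool) : 0 < letterWeight θ k l := by
  unfold letterWeight
  split_ifs
  · positivity
  · exact hθ k

lemma wordWeight_cons (θ : (Fin n → ℤ) → ℝ) (l : Fin n × Bool) (W : List (Fin n × Bool))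
    (k : Fin n → ℤ) : wordWeight θ (l :: W) k = letterWeight θ k l * wordWeight θ W k := by
  simp [wordWeight]

lemma isTemperate_letterWeight {θ : (Fin n → ℤ) → ℝ} (hθ : IsTemperate θ) (l : Fin n × Bool) :
    IsTemperate fun k => letterWeight θ k l := by
  unfold letterWeight
  split_ifs
  · exact isTemperate_one_add_abs l.1
  · exact hθ

lemma isTemperate_const {c : ℝ} (hc : 0 < c) : IsTemperate fun _ : Fin n → ℤ => c :=
  ⟨fun _ => hc, 1, 0, zero_le_one, fun _ _ => by simp⟩

lemma isTemperate_wordWeight {θ : (Fin n → ℤ) → ℝ} (hθ : IsTemperate θ)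
    (W : List (Fin n × Bool)) : IsTemperate (wordWeight θ W) := by
  induction W with
  | nil => exact isTemperate_const zero_lt_one
  | cons l W ih =>
    have := (isTemperate_letterWeight hθ l).mul ih
    simpa only [← wordWeight_cons] using this

lemma IsTemperate.pow {θ : (Fin n → ℤ) → ℝ} (hθ : IsTemperate θ) (N : ℕ) :
    IsTemperate fun k => θ k ^ N := by
  simpa using hθ.rpow N

/-- A product estimate for the Leibniz rule, at a fixed lattice point. -/
lemma norm_wordDiff_mul_le {c : ℝ} {ω : Fin n × Bool → ℝ} (h0 : ∀ l, 0 < ω l)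
    (hω : ∀ l, 1 ≤ c * ω l) (hc : 0 ≤ c) (k : Fin n → ℤ) (W : List (Fin n × Bool))
    (u v : (Fin n → ℤ) → ℂ) (A B : ℝ)
    (hu : ∀ U : List (Fin n × Bool), U.Sublist W →
      ‖wordDiff (U.map Prod.fst) u k‖ * (U.map ω).prod ≤ A)
    (hv : ∀ U : List (Fin n × Bool), U.Sublist W →
      ‖wordDiff (U.map Prod.fst) v k‖ * (U.map ω).prod ≤ B) :
    ‖wordDiff (W.map Prod.fst) (u * v) k‖ * (W.map ω).prod ≤
      (2 + c) ^ W.length * (A * B) := by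
  induction W generalizing u v A B with
  | nil =>
    have h1 := hu [] (List.Sublist.refl _)
    have h2 := hv [] (List.Sublist.refl _)
    simp only [List.map_nil, wordDiff_nil, List.prod_nil, mul_one, Pi.mul_apply, norm_mul,
      List.length_nil, pow_zero, one_mul] at h1 h2 ⊢
    exact mul_le_mul h1 h2 (norm_nonneg _) ((norm_nonneg _).trans h1)
  | cons l W ih =>
    have hl := h0 l
    have hA : 0 ≤ A := le_trans (by simp) (hu [] (List.nil_sublist _))
    have hB : 0 ≤ B := le_trans (by simp) (hv [] (List.nil_sublist _))
    set d := fwdDiff (M := Fin n → ℤ) (G := ℂ) (Pi.single l.1 (1 : ℤ)) with hd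
    have step : ∀ (f : (Fin n → ℤ) → ℂ) (D : ℝ), (∀ U : List (Fin n × Bool), U.Sublist (l :: W) →
        ‖wordDiff (U.map Prod.fst) f k‖ * (U.map ω).prod ≤ D) →
        (∀ U : List (Fin n × Bool), U.Sublist W →
          ‖wordDiff (U.map Prod.fst) (d f) k‖ * (U.map ω).prod ≤ D / ω l) ∧
        ∀ U : List (Fin n × Bool), U.Sublist W →
          ‖wordDiff (U.map Prod.fst) f k‖ * (U.map ω).prod ≤ D := by
      intro f D hf
      refine ⟨fun U hU => ?_, fun U hU => hf U (hU.cons l)⟩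
      rw [le_div_iff₀ hl, hd, wordDiff_fwdDiff, ← wordDiff_cons]
      have := hf (l :: U) (hU.cons_cons l)
      simp only [List.map_cons, List.prod_cons] at this
      linarith
    obtain ⟨hdu, hu'⟩ := step u A hu
    obtain ⟨hdv, hv'⟩ := step v B hv
    -- The discrete Leibniz rule `Δ(uv) = (Δu) v + u Δv + (Δu)(Δv)`. The last term gains `ω l`
    -- twice, and `1 ≤ c * ω l` discards the surplus; hence the factor `2 + c` per letter.
    have e : wordDiff ((l :: W).map Prod.fst) (u * v) =
        wordDiff (W.map Prod.fst) (d u * v) + wordDiff (W.map Prod.fst) (u * d v) +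
          wordDiff (W.map Prod.fst) (d u * d v) := by
      rw [List.map_cons, wordDiff_cons, ← wordDiff_fwdDiff, ← wordDiff_add, ← wordDiff_add]
      congr 1
      exact fwdDiff_smul _ u v
    have h1 := ih (d u) v _ _ hdu hv'
    have h2 := ih u (d v) _ _ hu' hdv
    have h3 := ih (d u) (d v) _ _ hdu hdv
    have hP : 0 ≤ (W.map ω).prod := List.prod_nonneg fun x hx => by
      obtain ⟨y, -, rfl⟩ := List.mem_map.1 hx
      exact (h0 y).le
    set P := (W.map ω).prod
    set q := (2 + c) ^ W.length with hq
    have hq0 : 0 ≤ q := by positivity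
    rw [e, List.map_cons, List.prod_cons, List.length_cons, pow_succ, ← hq]
    set x := wordDiff (W.map Prod.fst) (d u * v) k
    set y := wordDiff (W.map Prod.fst) (u * d v) k
    set z := wordDiff (W.map Prod.fst) (d u * d v) k
    have h4 : A * B / ω l ≤ c * (A * B) := by
      rw [div_le_iff₀ hl]
      nlinarith [mul_nonneg hA hB, hω l]
    have hx : ‖x‖ * (ω l * P) ≤ q * (A * B) := by
      calc ‖x‖ * (ω l * P) = ω l * (‖x‖ * P) := by ring
        _ ≤ ω l * (q * (A / ω l * B)) := by gcongr
        _ = _ := by field_simp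
    have hy : ‖y‖ * (ω l * P) ≤ q * (A * B) := by
      calc ‖y‖ * (ω l * P) = ω l * (‖y‖ * P) := by ring
        _ ≤ ω l * (q * (A * (B / ω l))) := by gcongr
        _ = _ := by field_simp
    have hz : ‖z‖ * (ω l * P) ≤ q * (c * (A * B)) := by
      calc ‖z‖ * (ω l * P) = ω l * (‖z‖ * P) := by ring
        _ ≤ ω l * (q * (A / ω l * (B / ω l))) := by gcongr
        _ = q * (A * B / ω l) := by field_simp
        _ ≤ _ := by gcongr
    calc ‖x + y + z‖ * (ω l * P) ≤ (‖x‖ + ‖y‖ + ‖z‖) * (ω l * P) := by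
          gcongr
          exact norm_add₃_le
      _ = ‖x‖ * (ω l * P) + ‖y‖ * (ω l * P) + ‖z‖ * (ω l * P) := by ring
      _ ≤ q * (A * B) + q * (A * B) + q * (c * (A * B)) := by gcongr
      _ = _ := by ring

/-- Makes constants uniform over the finitely many subwords met in the Leibniz rule. A directed
order, not just `ℝ`, lets a constant and an exponent be chosen as a pair. -/
lemma exists_uniform_bound {ι α : Type*} [Preorder α] [IsDirectedOrder α] [Nonempty α]
    {S : Set ι} (hS : S.Finite) {P : ι → α → Prop} (mono : ∀ i x y, x ≤ y → P i x → P i y)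
    (h : ∀ i ∈ S, ∃ x, P i x) : ∃ x, ∀ i ∈ S, P i x := by
  classical
  choose! f hf using h
  obtain ⟨x, hx⟩ := (hS.toFinset.image f).exists_le
  exact ⟨x, fun i hi => mono i _ _ (hx _ (Finset.mem_image_of_mem f (hS.mem_toFinset.2 hi)))
    (hf i hi)⟩

lemma finite_sublists {α : Type*} (W : List α) : {U : List α | U.Sublist W}.Finite :=
  (List.finite_toSet W.sublists).subset fun _ hU => List.mem_sublists.2 hU

lemma nodup_markedLetters_of_sublist {U W : List (Fin n × Bool)} (h : U.Sublist W)
    (hW : (markedLetters W).Nodup) : (markedLetters U).Nodup :=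
  hW.sublist ((h.filter _).map _)

lemma exists_uniform_coefClass {θ w : (Fin n → ℤ) → ℝ} (hw : ∀ k, 0 < w k)
    {a : (Fin n → ℤ) → (Fin n → ℤ) → ℂ} (ha : a ∈ coefClass θ w)
    {S : Set (List (Fin n × Bool))} (hS : S.Finite) (hSW : ∀ W ∈ S, (markedLetters W).Nodup)
    (M : ℕ) : ∃ C : ℝ, 0 ≤ C ∧ ∀ W ∈ S, ∀ k j,
      ‖wordDiff (W.map Prod.fst) a k j‖ * wordWeight θ W k * bracket j ^ M ≤ C * w k := by
  obtain ⟨C, hC⟩ := exists_uniform_bound hS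
    (P := fun W C => ∀ k j,
      ‖wordDiff (W.map Prod.fst) a k j‖ * wordWeight θ W k * bracket j ^ M ≤ C * w k)
    (fun W x y hxy h k j => (h k j).trans (mul_le_mul_of_nonneg_right hxy (hw k).le))
    (fun W hW => let ⟨C, _, hC⟩ := ha W (hSW W hW) M; ⟨C, hC⟩)
  exact ⟨max C 0, le_max_right _ _, fun W hW k j => (hC W hW k j).trans
    (mul_le_mul_of_nonneg_right (le_max_left _ _) (hw k).le)⟩

lemma markedLetters_map_false (L : List (Fin n)) :
    markedLetters (L.map fun i => (i, false)) = [] := by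
  simp [markedLetters, List.filter_map, Function.comp_def]

lemma wordWeight_map_false_append (θ : (Fin n → ℤ) → ℝ) (L : List (Fin n))
    (W : List (Fin n × Bool)) (k : Fin n → ℤ) :
    wordWeight θ (L.map (fun i => (i, false)) ++ W) k = θ k ^ L.length * wordWeight θ W k := by
  simp [wordWeight, List.prod_append, Function.comp_def, letterWeight]

/-- Symbol estimates for the Taylor remainders of the members of a coefficient family. -/
lemma exists_wordDiff_taylorRem_le {θ w : (Fin n → ℤ) → ℝ} (hθ : IsTemperate θ)
    (hw : IsTemperate w) {b : (Fin n → ℤ) → (Fin n → ℤ) → ℂ} (hb : b ∈ coefClass θ w) (N M : ℕ)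
    {V : List (Fin n × Bool)} (hV : (markedLetters V).Nodup) :
    ∃ (C : ℝ) (K : ℕ), 0 ≤ C ∧ ∀ j p k,
      ‖wordDiff (V.map Prod.fst) (taylorRem N j fun k => b k p) k‖ * wordWeight θ V k *
        bracket p ^ M ≤ C * bracket j ^ K * (w k / θ k ^ N) := by
  have hVw := isTemperate_wordWeight hθ V
  -- Remainders commute with differences, so the Taylor bound applies to the `V`-difference of `b`.
  -- Its differences of order `N` have size `w / (θ^N * wordWeight θ V)`, which is temperate.
  have hω := (hw.mul (hθ.pow N).inv).mul hVw.inv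
  obtain ⟨C, K, hC, hrem⟩ := exists_taylorRem_le N hω
  -- The `N` Taylor differences enter as unmarked letters, so the marked letters stay distinct.
  have hfin : (((fun L : List (Fin n) => L.map (fun i => (i, false)) ++ V) ''
      {L | L.length = N})).Finite := (List.finite_length_eq _ N).image _
  obtain ⟨D, hD, hDle⟩ := exists_uniform_coefClass hw.1 hb hfin
    (by
      rintro _ ⟨L, -, rfl⟩
      have : markedLetters (L.map (fun i => (i, false)) ++ V) = markedLetters V := by
        have := markedLetters_map_false L
        simp only [markedLetters, List.filter_append, List.map_append] at this ⊢
        rw [this, List.nil_append]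
      rwa [this]) M
  refine ⟨C * D, K, by positivity, fun j p k => ?_⟩
  have hp := bracket_pos p
  have hVk := hVw.1 k
  have hθk := hθ.1 k
  have := hrem (wordDiff (V.map Prod.fst) fun k => b k p) (D / bracket p ^ M) (by positivity)
    (fun L hL k => ?_) j k
  · rw [taylorRem_wordDiff] at this
    calc _ ≤ C * bracket j ^ K * (D / bracket p ^ M * (w k * (θ k ^ N)⁻¹ *
          (wordWeight θ V k)⁻¹)) * wordWeight θ V k * bracket p ^ M := by gcongr
      _ = _ := by field_simp
  · have h1 := hDle _ ⟨L, hL, rfl⟩ k p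
    simp only [List.map_append, List.map_map, Function.comp_def, List.map_id'] at h1
    rw [wordDiff_append, wordDiff_apply, wordWeight_map_false_append, hL] at h1
    have e : wordDiff (V.map Prod.fst) b = fun k p => wordDiff (V.map Prod.fst) (b · p) k :=
      funext fun k => funext fun p => wordDiff_apply _ _ _ _
    simp only [e] at h1
    have hVk := hVw.1 k
    have hθk := hθ.1 k
    have e2 : D / bracket p ^ M * (w k * (θ k ^ N)⁻¹ * (wordWeight θ V k)⁻¹) =
        D * w k / (θ k ^ N * wordWeight θ V k * bracket p ^ M) := by field_simp
    rw [e2, le_div_iff₀ (by positivity), ← mul_assoc]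
    exact h1

/-- The coefficients of the remainder of order `N` in the composition formula. -/
def compCoef (N : ℕ) (a b : (Fin n → ℤ) → (Fin n → ℤ) → ℂ) (k l : Fin n → ℤ) : ℂ :=
  ∑' j, a k j * taylorRem N j (fun k => b k (l - j)) k

lemma wordDiff_tsum {ι : Type*} (L : List (Fin n)) (F : ι → (Fin n → ℤ) → ℂ)
    (hF : ∀ k, Summable fun j => F j k) :
    (∀ k, Summable fun j => wordDiff L (F j) k) ∧
      wordDiff L (fun k => ∑' j, F j k) = fun k => ∑' j, wordDiff L (F j) k := by
  induction L with
  | nil => exact ⟨hF, rfl⟩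
  | cons i L ih =>
    obtain ⟨hs, he⟩ := ih
    refine ⟨fun k => (hs _).sub (hs k), ?_⟩
    rw [wordDiff_cons, he]
    funext k
    exact ((hs _).tsum_sub (hs k)).symm

/-- The bound for one term of the series `compCoef`, with a factor summable in `j`. It serves both
for convergence and for the estimate of the sum. -/
lemma exists_wordDiff_comp_le {θ v w : (Fin n → ℤ) → ℝ} (hθ : IsTemperate θ)
    {c : ℝ} (hc : 1 ≤ c) (hcθ : ∀ k, 1 ≤ c * θ k) (hv : ∀ k, 0 < v k) (hw : IsTemperate w)
    {a b : (Fin n → ℤ) → (Fin n → ℤ) → ℂ} (ha : a ∈ coefClass θ v) (hb : b ∈ coefClass θ w)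
    (N M : ℕ) {W : List (Fin n × Bool)} (hW : (markedLetters W).Nodup) :
    ∃ C : ℝ, 0 ≤ C ∧ ∀ j l k,
      ‖wordDiff (W.map Prod.fst)
          (fun k => a k j * taylorRem N j (fun k => b k (l - j)) k) k‖ *
        wordWeight θ W k * bracket l ^ M ≤
      C * (v k * w k / θ k ^ N) * (bracket j ^ (2 * n))⁻¹ := by
  obtain ⟨⟨B, K⟩, hBK⟩ := exists_uniform_bound (finite_sublists W)
    (P := fun V (x : ℝ × ℕ) => 0 ≤ x.1 ∧ ∀ j p k,
      ‖wordDiff (V.map Prod.fst) (taylorRem N j fun k => b k p) k‖ * wordWeight θ V k *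
        bracket p ^ M ≤ x.1 * bracket j ^ x.2 * (w k / θ k ^ N))
    (by
      rintro V ⟨x, m⟩ ⟨y, m'⟩ ⟨h1, h2⟩ ⟨h3, h4⟩
      refine ⟨h3.trans h1, fun j p k => (h4 j p k).trans ?_⟩
      have := hw.1 k
      have := hθ.1 k
      have := one_le_bracket j
      simp only at h1 h2 h3 ⊢
      gcongr
      exact h3.trans h1)
    (fun V hV => by
      obtain ⟨C, K, hC, h⟩ := exists_wordDiff_taylorRem_le hθ hw hb N M
        (nodup_markedLetters_of_sublist hV hW)
      exact ⟨⟨C, K⟩, hC, h⟩)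
  have hB : 0 ≤ B := (hBK W (List.Sublist.refl _)).1
  -- The decay of `a` in `j` is spent three ways: `M` to turn decay in `l - j` into decay in `l`,
  -- `K` for the growth of the remainder, and `2 * n` for summability.
  obtain ⟨A, hA, hAle⟩ := exists_uniform_coefClass hv ha (finite_sublists W)
    (fun V hV => nodup_markedLetters_of_sublist hV hW) (M + K + 2 * n)
  refine ⟨(2 + c) ^ W.length * (A * B), by positivity, fun j l k => ?_⟩
  have hj := bracket_pos j
  have hlj := bracket_pos (l - j)
  have hvk := hv k
  have hwk := hw.1 k
  have hθk := hθ.1 k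
  have hWk : 0 < wordWeight θ W k := (isTemperate_wordWeight hθ W).1 k
  have h := norm_wordDiff_mul_le (letterWeight_pos hθ.1 k) (c := c)
    (fun x => by
      unfold letterWeight
      split_ifs
      · nlinarith [abs_nonneg (k x.1 : ℝ)]
      · exact hcθ k) (zero_le_one.trans hc) k W (fun k => a k j)
    (taylorRem N j fun k => b k (l - j)) (A * v k / bracket j ^ (M + K + 2 * n))
    (B * bracket j ^ K * (w k / θ k ^ N) / bracket (l - j) ^ M)
    (fun U hU => by
      rw [le_div_iff₀ (by positivity), ← wordDiff_apply]
      exact hAle U hU k j)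
    (fun U hU => by
      rw [le_div_iff₀ (by positivity)]
      exact (hBK U hU).2 j (l - j) k)
  have hl : bracket l ≤ bracket j * bracket (l - j) := by
    simpa using bracket_add_le j (l - j)
  have hl0 := bracket_pos l
  calc _ ≤ (2 + c) ^ W.length * (A * v k / bracket j ^ (M + K + 2 * n) *
        (B * bracket j ^ K * (w k / θ k ^ N) / bracket (l - j) ^ M)) *
          bracket l ^ M := mul_le_mul_of_nonneg_right h (by positivity)
    _ ≤ (2 + c) ^ W.length * (A * v k / bracket j ^ (M + K + 2 * n) *
        (B * bracket j ^ K * (w k / θ k ^ N) / bracket (l - j) ^ M)) *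
          (bracket j * bracket (l - j)) ^ M := by gcongr
    _ = _ := by
        rw [mul_pow, pow_add, pow_add]
        field_simp

lemma summable_compCoef {θ v w : (Fin n → ℤ) → ℝ} (hθ : IsTemperate θ)
    {c : ℝ} (hc : 1 ≤ c) (hcθ : ∀ k, 1 ≤ c * θ k) (hv : ∀ k, 0 < v k) (hw : IsTemperate w)
    {a b : (Fin n → ℤ) → (Fin n → ℤ) → ℂ} (ha : a ∈ coefClass θ v) (hb : b ∈ coefClass θ w)
    (N : ℕ) (k l : Fin n → ℤ) :
    Summable fun j => a k j * taylorRem N j (fun k => b k (l - j)) k := by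
  obtain ⟨C, -, h⟩ := exists_wordDiff_comp_le hθ hc hcθ hv hw ha hb N 0 (W := []) List.nodup_nil
  refine Summable.of_norm_bounded ((summable_inv_bracket_pow n).mul_left
    (C * (v k * w k / θ k ^ N))) fun j => ?_
  simpa [wordWeight] using h j l k

/-- The composition estimate. -/
theorem compCoef_mem_coefClass {θ v w : (Fin n → ℤ) → ℝ} (hθ : IsTemperate θ)
    {c : ℝ} (hc : 1 ≤ c) (hcθ : ∀ k, 1 ≤ c * θ k) (hv : ∀ k, 0 < v k) (hw : IsTemperate w)
    {a b : (Fin n → ℤ) → (Fin n → ℤ) → ℂ} (ha : a ∈ coefClass θ v) (hb : b ∈ coefClass θ w)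
    (N : ℕ) : compCoef N a b ∈ coefClass θ fun k => v k * w k / θ k ^ N := by
  intro W hW M
  obtain ⟨C, hC, h⟩ := exists_wordDiff_comp_le hθ hc hcθ hv hw ha hb N M hW
  have hs := summable_inv_bracket_pow n
  refine ⟨C * ∑' j : Fin n → ℤ, (bracket j ^ (2 * n))⁻¹,
    mul_nonneg hC (tsum_nonneg fun j => inv_nonneg.2 (pow_nonneg (bracket_pos j).le _)),
    fun k l => ?_⟩
  rw [wordDiff_apply]
  have hWk : 0 < wordWeight θ W k := (isTemperate_wordWeight hθ W).1 k
  have hl := bracket_pos l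
  have e := (wordDiff_tsum (W.map Prod.fst)
    (fun j k => a k j * taylorRem N j (fun k => b k (l - j)) k)
    fun k => summable_compCoef hθ hc hcθ hv hw ha hb N k l).2
  have e' : (fun k => compCoef N a b k l) =
      fun k => ∑' j, a k j * taylorRem N j (fun k => b k (l - j)) k := rfl
  rw [e', e, mul_assoc, ← le_div_iff₀ (by positivity)]
  have hbd := tsum_of_norm_bounded ((hs.mul_left
    (C * (v k * w k / θ k ^ N) / (wordWeight θ W k * bracket l ^ M))).hasSum) (fun j => by
      rw [div_mul_eq_mul_div, le_div_iff₀ (by positivity), ← mul_assoc]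
      exact h j l k)
  refine hbd.trans (le_of_eq ?_)
  rw [tsum_mul_left]
  ring

end CoefClass

/-! ### Marked letters versus the operators `k_i Δ_i`. -/

section EulerEstimates

/-- The estimate of order `w` for the difference operator given by one word. -/
def IsWordBounded (θ w : (Fin n → ℤ) → ℝ) (W : List (Fin n × Bool))
    (F : (Fin n → ℤ) → (Fin n → ℤ) → ℂ) : Prop :=
  ∀ M : ℕ, ∃ C : ℝ, 0 ≤ C ∧
    ∀ k j, ‖wordDiff (W.map Prod.fst) F k j‖ * wordWeight θ W k * bracket j ^ M ≤ C * w k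

variable {θ w : (Fin n → ℤ) → ℝ}

lemma IsWordBounded.perm {W W' : List (Fin n × Bool)} {F : (Fin n → ℤ) → (Fin n → ℤ) → ℂ}
    (h : IsWordBounded θ w W F) (hp : W.Perm W') : IsWordBounded θ w W' F := by
  intro M
  obtain ⟨C, hC, h⟩ := h M
  refine ⟨C, hC, fun k j => ?_⟩
  have e : wordWeight θ W k = wordWeight θ W' k := (hp.map _).prod_eq
  rw [← wordDiff_perm (hp.map Prod.fst), ← e]
  exact h k j

lemma markedLetters_cons_true (i : Fin n) (W : List (Fin n × Bool)) :
    markedLetters ((i, true) :: W) = i :: markedLetters W := rfl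

lemma markedLetters_cons_false (i : Fin n) (W : List (Fin n × Bool)) :
    markedLetters ((i, false) :: W) = markedLetters W := rfl

/-- By `wordDiff_euler`, peeling `k_i Δ_i` off `G` leaves a marked letter `i` added to `W` and a
term with `W` unchanged. Distinctness across `W` and `G` keeps the longer word admissible. -/
lemma isWordBounded_eulerWord (hθ : ∀ k, 0 < θ k) {a : (Fin n → ℤ) → (Fin n → ℤ) → ℂ}
    (ha : a ∈ coefClass θ w) (G : List (Fin n)) (W : List (Fin n × Bool))
    (h : (markedLetters W ++ G).Nodup) : IsWordBounded θ w W (eulerWord G a) := by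
  induction G generalizing W with
  | nil => exact ha W (by simpa using h)
  | cons i G ih =>
    have h1 : (markedLetters ((i, true) :: W) ++ G).Nodup := by
      rw [markedLetters_cons_true, List.cons_append]
      exact (List.perm_middle.nodup_iff).1 h
    have h2 : (markedLetters W ++ G).Nodup := (List.nodup_cons.1 h1).2
    intro M
    obtain ⟨C, hC, hCle⟩ := ih _ h1 M
    obtain ⟨D, hD, hDle⟩ := ih _ h2 M
    set L := W.map Prod.fst with hL
    set q : ℝ := (L.count i : ℝ) with hq
    have hq0 : 0 ≤ q := Nat.cast_nonneg _
    refine ⟨(1 + q) * C + q * D, by positivity, fun k j => ?_⟩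
    have h3 := hCle k j
    have h4 := hDle k j
    simp only [List.map_cons, ← hL, wordWeight_cons, letterWeight, if_true] at h3 h4
    change ‖wordDiff L (euler i (eulerWord G a)) k j‖ * _ * _ ≤ _
    rw [wordDiff_euler]
    have hP : 0 < wordWeight θ W k := by
      refine List.prod_pos fun x hx => ?_
      obtain ⟨y, -, rfl⟩ := List.mem_map.1 hx
      exact letterWeight_pos hθ k y
    have hj := bracket_pos j
    set x := wordDiff (i :: L) (eulerWord G a) k
    set y := wordDiff L (eulerWord G a) k
    have hk := abs_nonneg (k i : ℝ)
    have hn : ‖(((k i : ℂ) + L.count i) • x + (L.count i : ℂ) • y) j‖ ≤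
        (1 + q) * (1 + |(k i : ℝ)|) * ‖x j‖ + q * ‖y j‖ := by
      simp only [Pi.add_apply, Pi.smul_apply, smul_eq_mul]
      refine (norm_add_le _ _).trans ?_
      rw [norm_mul, norm_mul, Complex.norm_natCast]
      gcongr
      refine (norm_add_le _ _).trans ?_
      rw [Complex.norm_natCast, Complex.norm_intCast]
      nlinarith
    calc _ ≤ ((1 + q) * (1 + |(k i : ℝ)|) * ‖x j‖ + q * ‖y j‖) * wordWeight θ W k *
          bracket j ^ M := by gcongr
      _ = (1 + q) * (‖x j‖ * ((1 + |(k i : ℝ)|) * wordWeight θ W k) * bracket j ^ M) +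
          q * (‖y j‖ * wordWeight θ W k * bracket j ^ M) := by ring
      _ ≤ (1 + q) * (C * w k) + q * (D * w k) := by gcongr
      _ = _ := by ring

/-- The reverse trade: a marked letter `i` of `W` becomes the operator `k_i Δ_i` in `G`. The
induction runs over all `G` and `L`, since letters also get demoted to unmarked ones collected in
`L`. -/
lemma isWordBounded_of_eulerWord (hθ : ∀ k, 0 < θ k) {c : ℝ} (hc : 0 ≤ c)
    (hcθ : ∀ k, 1 ≤ c * θ k) {a : (Fin n → ℤ) → (Fin n → ℤ) → ℂ}
    (ha : ∀ G : List (Fin n), G.Nodup → ∀ L : List (Fin n),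
      IsWordBounded θ w (L.map fun i => (i, false)) (eulerWord G a))
    (W : List (Fin n × Bool)) (G L : List (Fin n)) (h : (markedLetters W ++ G).Nodup) :
    IsWordBounded θ w (W ++ L.map fun i => (i, false)) (eulerWord G a) := by
  induction W generalizing G L with
  | nil => exact ha G (by simpa [markedLetters] using h) L
  | cons l W ih =>
    obtain ⟨i, b⟩ := l
    have hpush : (markedLetters W ++ G).Nodup → IsWordBounded θ w
        ((i, false) :: (W ++ L.map fun i => (i, false))) (eulerWord G a) := fun h' =>
      (ih G (i :: L) h').perm List.perm_middle
    cases b with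
    | false => exact hpush (by rwa [markedLetters_cons_false] at h)
    | true =>
      rw [markedLetters_cons_true, List.cons_append] at h
      have h2 : (markedLetters W ++ G).Nodup := (List.nodup_cons.1 h).2
      intro M
      -- In the three bounds the marked letter `i` becomes `k_i Δ_i` (`C`), is demoted to unmarked
      -- (`D`), or is dropped (`E`). They control the main part of `(1 + |k_i|) x`, the multiples of
      -- `x` alone, and the term in `y` from `wordDiff_euler`.
      obtain ⟨C, hC, hCle⟩ := ih (i :: G) L ((List.perm_middle.nodup_iff).2 h) M
      obtain ⟨D, hD, hDle⟩ := hpush h2 M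
      obtain ⟨E, hE, hEle⟩ := ih G L h2 M
      rw [List.cons_append]
      set V := W ++ L.map fun i => (i, false)
      set U := V.map Prod.fst with hU
      set q : ℝ := (U.count i : ℝ) with hq
      have hq0 : 0 ≤ q := Nat.cast_nonneg _
      refine ⟨C + (1 + q) * (c * D) + q * E, by positivity, fun k j => ?_⟩
      have h3 := hCle k j
      have h4 := hDle k j
      have h5 := hEle k j
      change ‖wordDiff U (euler i (eulerWord G a)) k j‖ * _ * _ ≤ _ at h3
      rw [wordDiff_euler] at h3
      simp only [List.map_cons, ← hU, wordWeight_cons, letterWeight, if_true, if_false,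
        Bool.false_eq_true] at h4 h5 ⊢
      have hP : 0 < wordWeight θ V k := by
        refine List.prod_pos fun x hx => ?_
        obtain ⟨y, -, rfl⟩ := List.mem_map.1 hx
        exact letterWeight_pos hθ k y
      have hj := bracket_pos j
      set x := wordDiff (i :: U) (eulerWord G a) k
      set y := wordDiff U (eulerWord G a) k
      set P := wordWeight θ V k * bracket j ^ M with hPdef
      have hP0 : 0 < P := by positivity
      set z := (((k i : ℂ) + U.count i) • x + (U.count i : ℂ) • y) j with hz
      have hn : (1 + |(k i : ℝ)|) * ‖x j‖ ≤ ‖z‖ + (1 + q) * ‖x j‖ + q * ‖y j‖ := by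
        have e : (k i : ℂ) * x j = z - (U.count i : ℂ) * x j - (U.count i : ℂ) * y j := by
          simp only [hz, Pi.add_apply, Pi.smul_apply, smul_eq_mul]
          ring
        have h6 : ‖(k i : ℂ) * x j‖ ≤ ‖z‖ + q * ‖x j‖ + q * ‖y j‖ := by
          rw [e]
          refine (norm_sub_le _ _).trans ?_
          rw [norm_mul _ (y j), Complex.norm_natCast]
          gcongr
          refine (norm_sub_le _ _).trans ?_
          rw [norm_mul _ (x j), Complex.norm_natCast]
        rw [norm_mul, Complex.norm_intCast] at h6
        linarith
      have h7 : ‖x j‖ * P ≤ c * D * w k := by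
        have h8 : ‖x j‖ * P ≤ ‖x j‖ * P * (c * θ k) :=
          le_mul_of_one_le_right (by positivity) (hcθ k)
        calc ‖x j‖ * P ≤ _ := h8
          _ = c * (‖x j‖ * (θ k * wordWeight θ V k) * bracket j ^ M) := by rw [hPdef]; ring
          _ ≤ c * (D * w k) := by gcongr
          _ = _ := by ring
      calc _ = (1 + |(k i : ℝ)|) * ‖x j‖ * P := by rw [hPdef]; ring
        _ ≤ (‖z‖ + (1 + q) * ‖x j‖ + q * ‖y j‖) * P := by gcongr
        _ = ‖z‖ * wordWeight θ V k * bracket j ^ M + (1 + q) * (‖x j‖ * P) +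
            q * (‖y j‖ * wordWeight θ V k * bracket j ^ M) := by rw [hPdef]; ring
        _ ≤ C * w k + (1 + q) * (c * D * w k) + q * (E * w k) := by gcongr
        _ = _ := by ring

lemma mem_coefClass_of_eulerWord (hθ : ∀ k, 0 < θ k) {c : ℝ} (hc : 0 ≤ c)
    (hcθ : ∀ k, 1 ≤ c * θ k) {a : (Fin n → ℤ) → (Fin n → ℤ) → ℂ}
    (ha : ∀ G : List (Fin n), G.Nodup → ∀ L : List (Fin n),
      IsWordBounded θ w (L.map fun i => (i, false)) (eulerWord G a)) : a ∈ coefClass θ w := by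
  intro W hW
  have := isWordBounded_of_eulerWord hθ hc hcθ ha W [] [] (by simpa using hW)
  rwa [List.map_nil, List.append_nil] at this

lemma row_mem_latticeSchwartz {a : (Fin n → ℤ) → (Fin n → ℤ) → ℂ} (ha : a ∈ coefClass θ w)
    (k : Fin n → ℤ) : a k ∈ latticeSchwartz n :=
  mem_latticeSchwartz_iff.2 fun M =>
    let ⟨C, _, h⟩ := ha [] List.nodup_nil M
    ⟨C * w k, fun j => by simpa [wordWeight] using h k j⟩

end EulerEstimates

/-! ### Falling factorials compared with powers. -/

section Falling

/-- The operators `D_x^{(β)}` multiply Fourier coefficients by falling factorials, so decay has to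
be read off from these. The induction uses `|z| ≤ |z - l| + l`, where `z - l` is the next factor. -/
lemma one_add_norm_pow_le_sum_falling (M : ℕ) : ∃ C : ℝ, 0 ≤ C ∧ ∀ z : ℂ,
    (1 + ‖z‖) ^ M ≤ C * ∑ l ∈ Finset.range (M + 1), ‖falling z l‖ := by
  induction M with
  | zero => exact ⟨1, zero_le_one, fun z => by simp [falling]⟩
  | succ M ih =>
    obtain ⟨C, hC, ih⟩ := ih
    refine ⟨C * (M + 2), by positivity, fun z => ?_⟩
    set S := ∑ l ∈ Finset.range (M + 2), ‖falling z l‖ with hS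
    have h1 : ∑ l ∈ Finset.range (M + 1), ‖falling z (l + 1)‖ ≤ S := by
      rw [hS, Finset.sum_range_succ' _ (M + 1)]
      exact le_add_of_nonneg_right (norm_nonneg _)
    have h2 : ∑ l ∈ Finset.range (M + 1), ‖falling z l‖ ≤ S := by
      rw [hS, Finset.sum_range_succ _ (M + 1)]
      exact le_add_of_nonneg_right (norm_nonneg _)
    have h3 : ∀ l ∈ Finset.range (M + 1), (1 + ‖z‖) * ‖falling z l‖ ≤
        ‖falling z (l + 1)‖ + (M + 1) * ‖falling z l‖ := by
      intro l hl
      have hl' : (l : ℝ) ≤ M := by exact_mod_cast Nat.lt_succ_iff.1 (Finset.mem_range.1 hl)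
      have h4 : ‖z‖ ≤ ‖z - l‖ + l := by
        simpa using norm_le_norm_sub_add z (l : ℂ)
      rw [falling_succ, norm_mul]
      nlinarith [norm_nonneg (falling z l)]
    calc (1 + ‖z‖) ^ (M + 1) = (1 + ‖z‖) ^ M * (1 + ‖z‖) := pow_succ _ _
      _ ≤ C * (∑ l ∈ Finset.range (M + 1), ‖falling z l‖) * (1 + ‖z‖) := by
          gcongr; exact ih z
      _ = C * ∑ l ∈ Finset.range (M + 1), (1 + ‖z‖) * ‖falling z l‖ := by
          rw [← Finset.mul_sum]; ring
      _ ≤ C * ∑ l ∈ Finset.range (M + 1), (‖falling z (l + 1)‖ + (M + 1) * ‖falling z l‖) := by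
          gcongr with l hl; exact h3 l hl
      _ ≤ C * (S + (M + 1) * S) := by
          rw [Finset.sum_add_distrib, ← Finset.mul_sum]; gcongr
      _ = _ := by ring

lemma bracket_le_prod (j : Fin n → ℤ) : bracket j ≤ ∏ i, (1 + |(j i : ℝ)|) := by
  unfold bracket
  induction (Finset.univ : Finset (Fin n)) using Finset.cons_induction with
  | empty => simp
  | cons i s hi ih =>
    rw [Finset.sum_cons, Finset.prod_cons]
    have h0 := abs_nonneg (j i : ℝ)
    have h1 : 0 ≤ ∑ i ∈ s, |(j i : ℝ)| := Finset.sum_nonneg fun _ _ => abs_nonneg _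
    nlinarith

/-- Powers of the bracket are controlled by finitely many falling factorials. -/
lemma bracket_pow_le_sum_miFalling (n M : ℕ) : ∃ (C : ℝ) (S : Finset (Fin n → ℕ)), 0 ≤ C ∧
    ∀ j : Fin n → ℤ, bracket j ^ M ≤ C * ∑ β ∈ S, ‖miFalling j β‖ := by
  obtain ⟨C, hC, h⟩ := one_add_norm_pow_le_sum_falling M
  refine ⟨C ^ n, Fintype.piFinset fun _ => Finset.range (M + 1), by positivity, fun j => ?_⟩
  calc bracket j ^ M ≤ (∏ i, (1 + |(j i : ℝ)|)) ^ M := by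
        gcongr
        · exact (bracket_pos j).le
        · exact bracket_le_prod j
    _ = ∏ i, (1 + ‖(j i : ℂ)‖) ^ M := by simp [Finset.prod_pow]
    _ ≤ ∏ i, (C * ∑ l ∈ Finset.range (M + 1), ‖falling (j i) l‖) :=
        Finset.prod_le_prod (fun _ _ => by positivity) fun i _ => h _
    _ = _ := by
        rw [Finset.prod_mul_distrib, Finset.prod_univ_sum]
        simp [miFalling, norm_prod]

lemma norm_falling_le (l : ℕ) : ∃ C : ℝ, 0 ≤ C ∧ ∀ z : ℂ, ‖falling z l‖ ≤ C * (1 + ‖z‖) ^ l := by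
  induction l with
  | zero => exact ⟨1, zero_le_one, fun z => by simp [falling]⟩
  | succ l ih =>
    obtain ⟨C, hC, ih⟩ := ih
    refine ⟨C * (1 + l), by positivity, fun z => ?_⟩
    have h : ‖z - l‖ ≤ (1 + l) * (1 + ‖z‖) := by
      have := norm_sub_le z (l : ℂ)
      rw [Complex.norm_natCast] at this
      have := mul_nonneg (Nat.cast_nonneg l : (0 : ℝ) ≤ l) (norm_nonneg z)
      linarith
    rw [falling_succ, norm_mul]
    calc _ ≤ ((1 + l) * (1 + ‖z‖)) * (C * (1 + ‖z‖) ^ l) := by gcongr; exact ih z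
      _ = _ := by ring

lemma norm_miFalling_le (β : Fin n → ℕ) : ∃ (C : ℝ) (K : ℕ), 0 ≤ C ∧
    ∀ j : Fin n → ℤ, ‖miFalling j β‖ ≤ C * bracket j ^ K := by
  choose C hC h using fun i => norm_falling_le (β i)
  refine ⟨∏ i, C i, ∑ i, β i, Finset.prod_nonneg fun i _ => hC i, fun j => ?_⟩
  rw [miFalling, norm_prod, ← Finset.prod_pow_eq_pow_sum, ← Finset.prod_mul_distrib]
  refine Finset.prod_le_prod (fun _ _ => norm_nonneg _) fun i _ => (h i _).trans ?_
  have := hC i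
  gcongr
  simpa using one_add_abs_le_bracket j i

lemma summable_norm_of_mem_latticeSchwartz {A : (Fin n → ℤ) → ℂ}
    (hA : A ∈ latticeSchwartz n) : Summable fun j => ‖A j‖ := by
  obtain ⟨C, hC⟩ := mem_latticeSchwartz_iff.1 hA (2 * n)
  refine Summable.of_nonneg_of_le (fun _ => norm_nonneg _) (fun j => ?_)
    ((summable_inv_bracket_pow n).mul_left C)
  rw [← div_eq_mul_inv, le_div_iff₀ (pow_pos (bracket_pos j) _)]
  exact hC j

end Falling

/-! ### The torus, its characters and Fourier coefficients. -/

section Torus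

open UnitAddTorus

/-- The quotient map `ℝⁿ → 𝕋ⁿ`. -/
def toTorus (y : Fin n → ℝ) : UnitAddTorus (Fin n) := fun i => (y i : UnitAddCircle)

lemma isOpenQuotientMap_toTorus : IsOpenQuotientMap (toTorus (n := n)) :=
  IsOpenQuotientMap.piMap fun _ => QuotientAddGroup.isOpenQuotientMap_mk

lemma toTorus_add_single (y : Fin n → ℝ) (i : Fin n) (t : ℝ) :
    toTorus (y + Pi.single i t) = toTorus y + Pi.single i (t : UnitAddCircle) := by
  funext a
  by_cases h : a = i
  · subst h; simp [toTorus]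
  · simp [toTorus, h]

lemma IsSmooth.continuous {g : UnitAddTorus (Fin n) → ℂ} (hg : IsSmooth g) : Continuous g :=
  isOpenQuotientMap_toTorus.isQuotientMap.continuous_iff.2 (ContDiff.continuous hg)

instance isProbabilityMeasure_torusMeasure : IsProbabilityMeasure (torusMeasure n) := by
  unfold torusMeasure; infer_instance

instance isAddLeftInvariant_torusMeasure : (torusMeasure n).IsAddLeftInvariant := by
  unfold torusMeasure; infer_instance

lemma integrable_of_continuous {g : UnitAddTorus (Fin n) → ℂ} (hg : Continuous g) :
    Integrable g (torusMeasure n) := by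
  exact (hg.continuousOn.integrableOn_compact isCompact_univ).integrable_of_forall_notMem_eq_zero
    (by simp)

/-- The Fourier coefficient of a function on the torus. -/
def coef (g : UnitAddTorus (Fin n) → ℂ) (j : Fin n → ℤ) : ℂ :=
  ∫ x, mFourier (-j) x * g x ∂(torusMeasure n)

lemma norm_mFourier_apply (j : Fin n → ℤ) (x : UnitAddTorus (Fin n)) : ‖mFourier j x‖ = 1 := by
  simp only [mFourier, ContinuousMap.coe_mk, norm_prod, fourier_apply, Circle.norm_coe,
    Finset.prod_const_one]

lemma norm_coef_le {g : UnitAddTorus (Fin n) → ℂ} {C : ℝ} (hC : ∀ x, ‖g x‖ ≤ C)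
    (j : Fin n → ℤ) : ‖coef g j‖ ≤ C := by
  have := norm_integral_le_of_norm_le_const (μ := torusMeasure n)
    (f := fun x => mFourier (-j) x * g x) (C := C)
    (Filter.Eventually.of_forall fun x => by rw [norm_mul, norm_mFourier_apply, one_mul]; exact hC x)
  simpa [coef] using this

lemma mFourier_toTorus (j : Fin n → ℤ) (y : Fin n → ℝ) :
    mFourier j (toTorus y) = Complex.exp (2 * Real.pi * Complex.I * ∑ i, (j i : ℂ) * y i) := by
  simp only [mFourier, ContinuousMap.coe_mk, toTorus, fourier_coe_apply, ← Complex.exp_sum,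
    Finset.mul_sum]
  congr 1
  refine Finset.sum_congr rfl fun i _ => ?_
  push_cast
  ring

lemma mFourier_add_apply (j : Fin n → ℤ) (x y : UnitAddTorus (Fin n)) :
    mFourier j (x + y) = mFourier j x * mFourier j y := by
  simp [mFourier, fourier_apply, smul_add, AddCircle.toCircle_add, Finset.prod_mul_distrib]

lemma mFourier_single_coe (j : Fin n → ℤ) (i : Fin n) (t : ℝ) :
    mFourier j (Pi.single i (t : UnitAddCircle)) =
      Complex.exp (2 * Real.pi * Complex.I * (j i : ℂ) * t) := by
  have e : (Pi.single i (t : UnitAddCircle) : UnitAddTorus (Fin n)) = toTorus (Pi.single i t) := by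
    have := toTorus_add_single (0 : Fin n → ℝ) i t
    rw [zero_add] at this
    rw [this]
    have h0 : toTorus (0 : Fin n → ℝ) = 0 := by funext a; simp [toTorus]
    rw [h0, zero_add]
  rw [e, mFourier_toTorus]
  congr 1
  rw [Finset.sum_eq_single i]
  · simp; ring
  · intro a _ ha; simp [ha]
  · simp

end Torus

/-! ### Smooth functions: derivatives, decay of coefficients, Fourier inversion. -/

section Derivative

open UnitAddTorus

variable {g h : UnitAddTorus (Fin n) → ℂ}

lemma IsSmooth.hasDerivAt_lift (hg : IsSmooth g) (y : Fin n → ℝ) (i : Fin n) :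
    HasDerivAt (fun t : ℝ => g (toTorus y + Pi.single i (t : UnitAddCircle)))
      (fderiv ℝ (fun y => g (toTorus y)) y (Pi.single i 1)) 0 := by
  have hd : DifferentiableAt ℝ (fun y => g (toTorus y)) y :=
    (ContDiff.differentiable hg (by simp)).differentiableAt
  have hl : HasDerivAt (fun t : ℝ => y + t • (Pi.single i 1 : Fin n → ℝ)) (Pi.single i 1) 0 := by
    simpa using ((hasDerivAt_id (0 : ℝ)).smul_const (Pi.single i 1 : Fin n → ℝ)).const_add y
  have := HasFDerivAt.comp_hasDerivAt_of_eq (0 : ℝ) hd.hasFDerivAt hl (by simp)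
  refine this.congr_of_eventuallyEq (Filter.Eventually.of_forall fun t => ?_)
  simp only [Function.comp_apply, ← toTorus_add_single, ← Pi.single_smul, smul_eq_mul, mul_one]

lemma IsSmooth.torusD_toTorus (hg : IsSmooth g) (i : Fin n) (y : Fin n → ℝ) :
    torusD i g (toTorus y) = (2 * Real.pi * Complex.I)⁻¹ *
      fderiv ℝ (fun y => g (toTorus y)) y (Pi.single i 1) := by
  rw [torusD, (hg.hasDerivAt_lift y i).deriv]

lemma isSmooth_torusD (hg : IsSmooth g) (i : Fin n) : IsSmooth (torusD i g) := by
  have e : (fun y : Fin n → ℝ => torusD i g (toTorus y)) = fun y =>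
      (2 * Real.pi * Complex.I)⁻¹ * fderiv ℝ (fun y => g (toTorus y)) y (Pi.single i 1) :=
    funext fun y => hg.torusD_toTorus i y
  change ContDiff ℝ _ (fun y : Fin n → ℝ => torusD i g (toTorus y))
  rw [e]
  exact contDiff_const.mul ((ContDiff.fderiv_right hg (by simp)).clm_apply contDiff_const)

lemma IsSmooth.hasDerivAt (hg : IsSmooth g) (x : UnitAddTorus (Fin n)) (i : Fin n) (t : ℝ) :
    HasDerivAt (fun t : ℝ => g (x + Pi.single i (t : UnitAddCircle)))
      (2 * Real.pi * Complex.I * torusD i g (x + Pi.single i (t : UnitAddCircle))) t := by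
  obtain ⟨y, rfl⟩ := isOpenQuotientMap_toTorus.surjective x
  have h1 := hg.hasDerivAt_lift (y + Pi.single i t) i
  rw [← toTorus_add_single, hg.torusD_toTorus, mul_inv_cancel_left₀ Complex.two_pi_I_ne_zero]
  have h2 := HasDerivAt.comp_sub_const (x := t) (a := t) (by rwa [sub_self])
  refine h2.congr_of_eventuallyEq (Filter.Eventually.of_forall fun s => ?_)
  simp only [← toTorus_add_single, add_assoc, ← Pi.single_add, add_sub_cancel]

lemma IsSmooth.sub (hg : IsSmooth g) (hh : IsSmooth h) : IsSmooth fun x => g x - h x :=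
  ContDiff.sub hg hh

lemma IsSmooth.mul (hg : IsSmooth g) (hh : IsSmooth h) : IsSmooth fun x => g x * h x :=
  ContDiff.mul hg hh

lemma isSmooth_const (c : ℂ) : IsSmooth fun _ : UnitAddTorus (Fin n) => c :=
  contDiff_const

lemma IsSmooth.sum {ι : Type*} {s : Finset ι} {f : ι → UnitAddTorus (Fin n) → ℂ}
    (hf : ∀ i ∈ s, IsSmooth (f i)) : IsSmooth fun x => ∑ i ∈ s, f i x :=
  ContDiff.sum hf

lemma isSmooth_torusDFall (hg : IsSmooth g) (i : Fin n) (l : ℕ) : IsSmooth (torusDFall i l g) := by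
  induction l with
  | zero => exact hg
  | succ l ih => exact (isSmooth_torusD ih i).sub ((isSmooth_const _).mul ih)

lemma coef_sub (hg : Continuous g) (hh : Continuous h) (j : Fin n → ℤ) :
    coef (fun x => g x - h x) j = coef g j - coef h j := by
  simp only [coef, mul_sub]
  exact integral_sub (integrable_of_continuous (by fun_prop))
    (integrable_of_continuous (by fun_prop))

lemma coef_const_mul (c : ℂ) (g : UnitAddTorus (Fin n) → ℂ) (j : Fin n → ℤ) :
    coef (fun x => c * g x) j = c * coef g j := by
  simp only [coef, mul_left_comm _ c, integral_const_mul]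

lemma coef_sum {ι : Type*} {s : Finset ι} {f : ι → UnitAddTorus (Fin n) → ℂ}
    (hf : ∀ i ∈ s, Continuous (f i)) (j : Fin n → ℤ) :
    coef (fun x => ∑ i ∈ s, f i x) j = ∑ i ∈ s, coef (f i) j := by
  simp only [coef, Finset.mul_sum]
  exact integral_finsetSum _ fun i hi => integrable_of_continuous
    (by have := hf i hi; fun_prop)

lemma coef_translate (g : UnitAddTorus (Fin n) → ℂ) (j : Fin n → ℤ) (i : Fin n) (t : ℝ) :
    ∫ x, mFourier (-j) x * g (x + Pi.single i (t : UnitAddCircle)) ∂(torusMeasure n) =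
      Complex.exp (2 * Real.pi * Complex.I * (j i : ℂ) * t) * coef g j := by
  rw [coef, ← integral_const_mul]
  have h := integral_add_right_eq_self (μ := torusMeasure n)
    (fun x => Complex.exp (2 * Real.pi * Complex.I * (j i : ℂ) * t) * (mFourier (-j) x * g x))
    (Pi.single i (t : UnitAddCircle))
  rw [← h]
  congr 1
  funext x
  rw [mFourier_add_apply, mFourier_single_coe, ← mul_assoc, ← mul_assoc,
    mul_comm (Complex.exp _) (mFourier (-j) x), mul_assoc (mFourier (-j) x), ← Complex.exp_add]
  have : 2 * Real.pi * Complex.I * (j i : ℂ) * t +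
      2 * Real.pi * Complex.I * (((-j) i : ℤ) : ℂ) * t = 0 := by
    rw [Pi.neg_apply]; push_cast; ring
  rw [this, Complex.exp_zero, mul_one]

/-- Integration by parts on the torus. -/
lemma coef_torusD (hg : IsSmooth g) (i : Fin n) (j : Fin n → ℤ) :
    coef (torusD i g) j = j i * coef g j := by
  have hD := (isSmooth_torusD hg i).continuous
  have hc := hg.continuous
  obtain ⟨C, hC⟩ := (isCompact_range hD.norm).bddAbove
  have hC' : ∀ x, ‖torusD i g x‖ ≤ C := fun x => hC ⟨x, rfl⟩
  have hF : ∀ t : ℝ, Continuous fun x =>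
      mFourier (-j) x * g (x + Pi.single i (t : UnitAddCircle)) := fun t => by fun_prop
  have hF' : Continuous fun x => mFourier (-j) x *
      (2 * Real.pi * Complex.I * torusD i g (x + Pi.single i ((0 : ℝ) : UnitAddCircle))) := by
    fun_prop
  -- The integral against a translate of `g` is differentiated at `t = 0` in two ways: under the
  -- integral sign, and through the character factor of `coef_translate`.
  have key : HasDerivAt (fun t : ℝ => ∫ x, mFourier (-j) x *
        g (x + Pi.single i (t : UnitAddCircle)) ∂(torusMeasure n))
      (∫ x, mFourier (-j) x * (2 * Real.pi * Complex.I *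
        torusD i g (x + Pi.single i ((0 : ℝ) : UnitAddCircle))) ∂(torusMeasure n)) 0 := by
    refine (hasDerivAt_integral_of_dominated_loc_of_deriv_le (𝕜 := ℝ) (x₀ := (0 : ℝ))
      (F := fun (t : ℝ) x => mFourier (-j) x * g (x + Pi.single i (t : UnitAddCircle)))
      (bound := fun _ => ‖2 * Real.pi * Complex.I‖ * C)
      (F' := fun (t : ℝ) x => mFourier (-j) x *
        (2 * Real.pi * Complex.I * torusD i g (x + Pi.single i (t : UnitAddCircle))))
      Filter.univ_mem ?_ ?_ ?_ ?_ (integrable_const (μ := torusMeasure n) _) ?_).2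
    · exact Filter.Eventually.of_forall fun t =>
        (integrable_of_continuous (hF t)).aestronglyMeasurable
    · exact integrable_of_continuous (hF 0)
    · exact (integrable_of_continuous hF').aestronglyMeasurable
    · refine Filter.Eventually.of_forall fun x t _ => ?_
      rw [norm_mul, norm_mFourier_apply, one_mul, norm_mul]
      exact mul_le_mul_of_nonneg_left (hC' _) (norm_nonneg _)
    · exact Filter.Eventually.of_forall fun x t _ => (hg.hasDerivAt x i t).const_mul _
  simp only [coef_translate] at key
  have h2 : HasDerivAt (fun t : ℝ => Complex.exp (2 * Real.pi * Complex.I * (j i : ℂ) * t) *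
      coef g j) (2 * Real.pi * Complex.I * (j i : ℂ) * coef g j) 0 := by
    have h3 : HasDerivAt (fun t : ℝ => 2 * Real.pi * Complex.I * (j i : ℂ) * (t : ℂ))
        (2 * Real.pi * Complex.I * (j i : ℂ)) 0 := by
      simpa using (Complex.ofRealCLM.hasDerivAt (x := (0 : ℝ))).const_mul
        (2 * Real.pi * Complex.I * (j i : ℂ))
    simpa using h3.cexp.mul_const (coef g j)
  have h4 := key.unique h2
  simp only [mul_left_comm (mFourier (-j) _), integral_const_mul] at h4
  rw [mul_assoc (2 * Real.pi * Complex.I : ℂ)] at h4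
  have h5 := mul_left_cancel₀ Complex.two_pi_I_ne_zero h4
  simpa [coef] using h5

lemma coef_torusDFall (hg : IsSmooth g) (i : Fin n) (l : ℕ) (j : Fin n → ℤ) :
    coef (torusDFall i l g) j = falling (j i) l * coef g j := by
  induction l with
  | zero => simp [torusDFall, falling]
  | succ l ih =>
    have h1 := isSmooth_torusDFall hg i l
    have h2 := isSmooth_torusD h1 i
    change coef (fun x => torusD i (torusDFall i l g) x - (l : ℂ) * torusDFall i l g x) j = _
    rw [coef_sub (h := fun x => (l : ℂ) * torusDFall i l g x) h2.continuous
      (continuous_const.mul h1.continuous), coef_const_mul, coef_torusD h1, ih, falling_succ]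
    ring

lemma isSmooth_torusDiff_and_coef (hg : IsSmooth g) (β : Fin n → ℕ) :
    IsSmooth (torusDiff β g) ∧ ∀ j, coef (torusDiff β g) j = miFalling j β * coef g j := by
  have key : ∀ l : List (Fin n), IsSmooth (l.foldr (fun j h => torusDFall j (β j) h) g) ∧
      ∀ j : Fin n → ℤ, coef (l.foldr (fun j h => torusDFall j (β j) h) g) j =
        (l.map fun i => falling (j i) (β i)).prod * coef g j := by
    intro l
    induction l with
    | nil => exact ⟨hg, fun j => by simp⟩
    | cons i l ih =>
      refine ⟨isSmooth_torusDFall ih.1 i (β i), fun j => ?_⟩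
      rw [List.foldr_cons, coef_torusDFall ih.1, ih.2, List.map_cons, List.prod_cons, mul_assoc]
  refine ⟨(key _).1, fun j => ?_⟩
  rw [torusDiff, (key _).2, miFalling, ← List.ofFn_eq_map, List.prod_ofFn]

lemma isSmooth_torusDiff (hg : IsSmooth g) (β : Fin n → ℕ) : IsSmooth (torusDiff β g) :=
  (isSmooth_torusDiff_and_coef hg β).1

lemma coef_torusDiff (hg : IsSmooth g) (β : Fin n → ℕ) (j : Fin n → ℤ) :
    coef (torusDiff β g) j = miFalling j β * coef g j :=
  (isSmooth_torusDiff_and_coef hg β).2 j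

lemma coef_mem_latticeSchwartz (hg : IsSmooth g) : coef g ∈ latticeSchwartz n := by
  refine mem_latticeSchwartz_iff.2 fun M => ?_
  obtain ⟨C, S, hC, h⟩ := bracket_pow_le_sum_miFalling n M
  have hb : ∀ β : Fin n → ℕ, ∃ B : ℝ, ∀ x, ‖torusDiff β g x‖ ≤ B := fun β =>
    let ⟨B, hB⟩ := (isCompact_range (isSmooth_torusDiff hg β).continuous.norm).bddAbove
    ⟨B, fun x => hB ⟨x, rfl⟩⟩
  choose B hB using hb
  refine ⟨C * ∑ β ∈ S, B β, fun j => ?_⟩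
  calc ‖coef g j‖ * bracket j ^ M ≤ ‖coef g j‖ * (C * ∑ β ∈ S, ‖miFalling j β‖) := by
        gcongr; exact h j
    _ = C * ∑ β ∈ S, ‖coef (torusDiff β g) j‖ := by
        simp only [coef_torusDiff hg, norm_mul, ← Finset.sum_mul]; ring
    _ ≤ _ := by gcongr with β; exact norm_coef_le (hB β) j

/-- Fourier inversion for smooth functions on the torus. -/
lemma hasSum_coef (hg : IsSmooth g) (x : UnitAddTorus (Fin n)) :
    HasSum (fun j => coef g j * mFourier j x) (g x) := by
  have hs : Summable (mFourierCoeff (⟨g, hg.continuous⟩ : C(UnitAddTorus (Fin n), ℂ))) :=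
    (summable_norm_of_mem_latticeSchwartz (coef_mem_latticeSchwartz hg)).of_norm
  -- `coef` agrees with `mFourierCoeff` by unfolding.
  exact hasSum_mFourier_series_apply_of_summable hs x

lemma norm_le_tsum_coef (hg : IsSmooth g) (x : UnitAddTorus (Fin n)) :
    ‖g x‖ ≤ ∑' j, ‖coef g j‖ := by
  rw [← (hasSum_coef hg x).tsum_eq]
  refine tsum_of_norm_bounded
    (summable_norm_of_mem_latticeSchwartz (coef_mem_latticeSchwartz hg)).hasSum fun j => ?_
  rw [norm_mul, norm_mFourier_apply, mul_one]

end Derivative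

/-! ### Functions with prescribed coefficients; coefficients of products. -/

section Synthesis

open UnitAddTorus

/-- The function on the torus with given Fourier coefficients. -/
def synth (A : (Fin n → ℤ) → ℂ) (x : UnitAddTorus (Fin n)) : ℂ := ∑' j, A j * mFourier j x

/-- The linear form `y ↦ y_i` with complex values. -/
def coordCLM (i : Fin n) : (Fin n → ℝ) →L[ℝ] ℂ :=
  Complex.ofRealCLM.comp (ContinuousLinearMap.proj i)

lemma norm_coordCLM_le (i : Fin n) : ‖coordCLM i‖ ≤ 1 :=
  ContinuousLinearMap.opNorm_le_bound _ zero_le_one fun y => by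
    simpa [coordCLM] using norm_le_pi_norm y i

/-- The phase `2πi j · y` as a linear form in `y`. -/
def phaseCLM (j : Fin n → ℤ) : (Fin n → ℝ) →L[ℝ] ℂ :=
  ∑ i, (2 * Real.pi * Complex.I * (j i : ℂ)) • coordCLM i

lemma mFourier_toTorus_eq_phase (j : Fin n → ℤ) (y : Fin n → ℝ) :
    mFourier j (toTorus y) = Complex.exp (phaseCLM j y) := by
  rw [mFourier_toTorus]
  simp [phaseCLM, coordCLM, Finset.mul_sum, mul_assoc]

lemma norm_phaseCLM_le (j : Fin n → ℤ) : ‖phaseCLM j‖ ≤ 2 * Real.pi * bracket j := by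
  calc ‖phaseCLM j‖ ≤ ∑ i, ‖(2 * Real.pi * Complex.I * (j i : ℂ)) • coordCLM i‖ :=
        norm_sum_le _ _
    _ ≤ ∑ i, 2 * Real.pi * |(j i : ℝ)| := by
        refine Finset.sum_le_sum fun i _ => ?_
        rw [norm_smul]
        have : ‖2 * Real.pi * Complex.I * (j i : ℂ)‖ = 2 * Real.pi * |(j i : ℝ)| := by
          simp [abs_of_pos Real.pi_pos]
        rw [this]
        exact mul_le_of_le_one_right (by positivity) (norm_coordCLM_le i)
    _ ≤ _ := by
        rw [← Finset.mul_sum, bracket]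
        have := Real.pi_pos
        gcongr
        linarith

lemma coord_mul_mem_latticeSchwartz (i : Fin n) {A : (Fin n → ℤ) → ℂ}
    (hA : A ∈ latticeSchwartz n) :
    (fun j => (2 * Real.pi * Complex.I * (j i : ℂ)) * A j) ∈ latticeSchwartz n := by
  rw [mem_latticeSchwartz_iff] at hA ⊢
  intro M
  obtain ⟨C, hC⟩ := hA (M + 1)
  refine ⟨2 * Real.pi * C, fun j => ?_⟩
  have hj := bracket_pos j
  have h1 := one_add_abs_le_bracket j i
  have e : ‖2 * Real.pi * Complex.I * (j i : ℂ)‖ = 2 * Real.pi * |(j i : ℝ)| := by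
    simp [abs_of_pos Real.pi_pos]
  rw [norm_mul, e]
  have := Real.pi_pos
  calc 2 * Real.pi * |(j i : ℝ)| * ‖A j‖ * bracket j ^ M
      ≤ 2 * Real.pi * bracket j * ‖A j‖ * bracket j ^ M := by gcongr; linarith
    _ = 2 * Real.pi * (‖A j‖ * bracket j ^ (M + 1)) := by ring
    _ ≤ _ := by gcongr; exact hC j

lemma summable_synth {A : (Fin n → ℤ) → ℂ} (hA : A ∈ latticeSchwartz n)
    (x : UnitAddTorus (Fin n)) : Summable fun j => A j * mFourier j x :=
  Summable.of_norm_bounded (summable_norm_of_mem_latticeSchwartz hA) fun j => by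
    rw [norm_mul, norm_mFourier_apply, mul_one]

/-- The derivative is written through `synth` of the sequences `2πi j_i A_j`, which are again
rapidly decreasing; smoothness then follows by induction over all such `A`. -/
lemma hasFDerivAt_synth {A : (Fin n → ℤ) → ℂ} (hA : A ∈ latticeSchwartz n) (y : Fin n → ℝ) :
    HasFDerivAt (fun y => synth A (toTorus y))
      (∑ i, synth (fun j => (2 * Real.pi * Complex.I * (j i : ℂ)) * A j) (toTorus y) •
        coordCLM i) y := by
  have hf : ∀ (j : Fin n → ℤ) (y : Fin n → ℝ),
      HasFDerivAt (fun y : Fin n → ℝ => A j * mFourier j (toTorus y))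
        ((A j * mFourier j (toTorus y)) • phaseCLM j) y := by
    intro j y
    simp only [mFourier_toTorus_eq_phase, mul_smul]
    exact (phaseCLM j).hasFDerivAt.cexp.const_mul (A j)
  obtain ⟨C, hC⟩ := mem_latticeSchwartz_iff.1 hA (2 * n + 1)
  have hbd : ∀ (j : Fin n → ℤ) (y : Fin n → ℝ), ‖(A j * mFourier j (toTorus y)) • phaseCLM j‖ ≤
      2 * Real.pi * C * (bracket j ^ (2 * n))⁻¹ := by
    intro j y
    have hj := bracket_pos j
    rw [norm_smul, norm_mul, norm_mFourier_apply, mul_one, ← div_eq_mul_inv,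
      le_div_iff₀ (by positivity)]
    have := Real.pi_pos
    calc ‖A j‖ * ‖phaseCLM j‖ * bracket j ^ (2 * n)
        ≤ ‖A j‖ * (2 * Real.pi * bracket j) * bracket j ^ (2 * n) := by
          gcongr; exact norm_phaseCLM_le j
      _ = 2 * Real.pi * (‖A j‖ * bracket j ^ (2 * n + 1)) := by ring
      _ ≤ _ := by gcongr; exact hC j
  have := hasFDerivAt_tsum ((summable_inv_bracket_pow n).mul_left (2 * Real.pi * C)) hf hbd
    (summable_synth hA (toTorus 0)) y
  refine this.congr_fderiv ?_
  have e : ∀ j : Fin n → ℤ, (A j * mFourier j (toTorus y)) • phaseCLM j =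
      ∑ i, ((2 * Real.pi * Complex.I * (j i : ℂ)) * A j * mFourier j (toTorus y)) •
        coordCLM i := by
    intro j
    rw [phaseCLM, Finset.smul_sum]
    refine Finset.sum_congr rfl fun i _ => ?_
    rw [smul_smul]
    congr 1
    ring
  rw [tsum_congr e, Summable.tsum_finsetSum fun i _ =>
    (summable_synth (coord_mul_mem_latticeSchwartz i hA) _).smul_const _]
  refine Finset.sum_congr rfl fun i _ => ?_
  exact ((summable_synth (coord_mul_mem_latticeSchwartz i hA) _).hasSum.smul_const _).tsum_eq

lemma isSmooth_synth {A : (Fin n → ℤ) → ℂ} (hA : A ∈ latticeSchwartz n) : IsSmooth (synth A) := by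
  refine contDiff_infty.2 fun m => ?_
  change ContDiff ℝ m fun y : Fin n → ℝ => synth A (toTorus y)
  induction m generalizing A with
  | zero =>
    exact contDiff_zero.2 (continuous_iff_continuousAt.2 fun y =>
      (hasFDerivAt_synth hA y).continuousAt)
  | succ m ih =>
    rw [Nat.cast_add, Nat.cast_one, contDiff_succ_iff_fderiv]
    refine ⟨fun y => (hasFDerivAt_synth hA y).differentiableAt, by simp, ?_⟩
    rw [funext fun y => (hasFDerivAt_synth hA y).fderiv]
    exact ContDiff.sum fun i _ => (ih (coord_mul_mem_latticeSchwartz i hA)).smul contDiff_const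

/-- Integration of an absolutely convergent trigonometric series against a continuous function. -/
lemma hasSum_integral_mFourier {ι : Type*} [Countable ι] {A : ι → ℂ} (hA : Summable fun j => ‖A j‖)
    (s : ι → Fin n → ℤ) {h : UnitAddTorus (Fin n) → ℂ} (hh : Continuous h) :
    HasSum (fun j => A j * ∫ x, mFourier (s j) x * h x ∂(torusMeasure n))
      (∫ x, (∑' j, A j * mFourier (s j) x) * h x ∂(torusMeasure n)) := by
  obtain ⟨C, hC⟩ := (isCompact_range hh.norm).bddAbove
  have hC' : ∀ x, ‖h x‖ ≤ C := fun x => hC ⟨x, rfl⟩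
  have hint : ∀ j, Integrable (fun x => A j * (mFourier (s j) x * h x)) (torusMeasure n) :=
    fun j => integrable_of_continuous (by fun_prop)
  have hsum : Summable fun j => ∫ x, ‖A j * (mFourier (s j) x * h x)‖ ∂(torusMeasure n) := by
    refine Summable.of_nonneg_of_le (fun j => integral_nonneg fun _ => norm_nonneg _)
      (fun j => ?_) (hA.mul_right C)
    calc ∫ x, ‖A j * (mFourier (s j) x * h x)‖ ∂(torusMeasure n)
        ≤ ∫ _x, ‖A j‖ * C ∂(torusMeasure n) := by
          refine integral_mono (hint j).norm (integrable_const _) fun x => ?_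
          simp only [norm_mul, norm_mFourier_apply, one_mul]
          gcongr
          exact hC' x
      _ = ‖A j‖ * C := by simp
  have := hasSum_integral_of_summable_integral_norm hint hsum
  simp only [integral_const_mul] at this
  simpa only [← tsum_mul_right, mul_assoc] using this

/-- For `m ≠ 0`, apply `coef_torusD` to the constant `1`: its derivative vanishes, so a nonzero
component of `m` annihilates the integral. -/
lemma integral_mFourier (m : Fin n → ℤ) :
    ∫ x, mFourier m x ∂(torusMeasure n) = if m = 0 then 1 else 0 := by
  have e : ∫ x, mFourier m x ∂(torusMeasure n) =
      coef (fun _ : UnitAddTorus (Fin n) => (1 : ℂ)) (-m) := by simp [coef]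
  split_ifs with h
  · simp [h, mFourier_zero]
  · obtain ⟨i, hi⟩ := Function.ne_iff.1 h
    have h1 := coef_torusD (isSmooth_const (n := n) 1) i (-m)
    have h2 : torusD i (fun _ : UnitAddTorus (Fin n) => (1 : ℂ)) = fun _ => 0 := by
      funext x; simp [torusD]
    rw [h2] at h1
    rw [e]
    simp only [coef, mul_zero, integral_zero] at h1 ⊢
    rcases mul_eq_zero.1 h1.symm with h3 | h3
    · simp at h3; exact absurd h3 hi
    · exact h3

lemma coef_synth {A : (Fin n → ℤ) → ℂ} (hA : A ∈ latticeSchwartz n) (l : Fin n → ℤ) :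
    coef (synth A) l = A l := by
  have h := hasSum_integral_mFourier (summable_norm_of_mem_latticeSchwartz hA) (fun j => j)
    (mFourier (-l)).continuous
  simp only [← mFourier_add, integral_mFourier] at h
  have h2 : HasSum (fun j => A j * if j + -l = 0 then 1 else 0) (A l) := by
    have := hasSum_ite_eq l (A l)
    refine this.congr_fun fun j => ?_
    by_cases hj : j = l
    · simp [hj]
    · simp [hj, ← sub_eq_add_neg, sub_eq_zero]
  rw [← h.unique h2]
  simp only [coef, synth, mul_comm]

/-- The Fourier coefficients of a product. -/
lemma hasSum_coef_mul {g h : UnitAddTorus (Fin n) → ℂ} (hg : IsSmooth g) (hh : Continuous h)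
    (l : Fin n → ℤ) :
    HasSum (fun j => coef g j * coef h (l - j)) (coef (fun x => g x * h x) l) := by
  have := hasSum_integral_mFourier
    (summable_norm_of_mem_latticeSchwartz (coef_mem_latticeSchwartz hg)) (fun j => j)
    (h := fun x => mFourier (-l) x * h x) (by fun_prop)
  have e1 : ∀ j, ∫ x, mFourier j x * (mFourier (-l) x * h x) ∂(torusMeasure n) =
      coef h (l - j) := fun j => by
    simp only [coef, ← mul_assoc, ← mFourier_add, neg_sub, sub_eq_add_neg j l]
  have e2 : ∫ x, (∑' j, coef g j * mFourier j x) * (mFourier (-l) x * h x) ∂(torusMeasure n) =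
      coef (fun x => g x * h x) l := by
    simp only [(hasSum_coef hg _).tsum_eq]
    simp only [coef, mul_left_comm]
  rwa [e2, funext fun j => congrArg (coef g j * ·) (e1 j)] at this

end Synthesis

/-! ### Symbol classes described by Fourier coefficients. -/

section SymbolClasses

variable {Λ : (Fin n → ℤ) → ℝ} {μ ρ : ℝ}

lemma IsWeight.exists_one_le_mul_rpow (h : IsWeight μ Λ) (hρ : 0 < ρ) :
    ∃ c : ℝ, 1 ≤ c ∧ ∀ k, 1 ≤ c * Λ k ^ ρ := by
  obtain ⟨δ, hδ, hle⟩ := h.exists_pos_le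
  have hδρ : 0 < δ ^ ρ := Real.rpow_pos_of_pos hδ ρ
  refine ⟨max 1 (δ ^ ρ)⁻¹, le_max_left _ _, fun k => ?_⟩
  have h1 : δ ^ ρ ≤ Λ k ^ ρ := Real.rpow_le_rpow hδ.le (hle k) hρ.le
  calc 1 = (δ ^ ρ)⁻¹ * δ ^ ρ := (inv_mul_cancel₀ hδρ.ne').symm
    _ ≤ max 1 (δ ^ ρ)⁻¹ * Λ k ^ ρ := by gcongr; exact le_max_right _ _

lemma IsWeight.rpow_sub_mul_natCast (h : IsWeight μ Λ) (s : ℝ) (l : ℕ) (k : Fin n → ℤ) :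
    Λ k ^ (s - ρ * l) = Λ k ^ s / (Λ k ^ ρ) ^ l := by
  rw [Real.rpow_sub (h.pos k), Real.rpow_mul (h.pos k).le, Real.rpow_natCast]

lemma isSmooth_wordDiff_and_coef {σ : (Fin n → ℤ) → UnitAddTorus (Fin n) → ℂ}
    (hσ : ∀ k, IsSmooth (σ k)) (L : List (Fin n)) (k : Fin n → ℤ) :
    IsSmooth (wordDiff L σ k) ∧ coef (wordDiff L σ k) = wordDiff L (fun k => coef (σ k)) k := by
  induction L generalizing k with
  | nil => exact ⟨hσ k, rfl⟩
  | cons i L ih =>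
    refine ⟨(ih _).1.sub (ih k).1, ?_⟩
    change _ = wordDiff L (fun k => coef (σ k)) (k + Pi.single i 1) -
      wordDiff L (fun k => coef (σ k)) k
    rw [← (ih _).2, ← (ih k).2]
    exact funext fun j => coef_sub (ih _).1.continuous (ih k).1.continuous j

lemma isSmooth_eulerWord_and_coef {σ : (Fin n → ℤ) → UnitAddTorus (Fin n) → ℂ}
    (hσ : ∀ k, IsSmooth (σ k)) (G : List (Fin n)) (k : Fin n → ℤ) :
    IsSmooth (eulerWord G σ k) ∧ coef (eulerWord G σ k) = eulerWord G (fun k => coef (σ k)) k := by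
  induction G generalizing k with
  | nil => exact ⟨hσ k, rfl⟩
  | cons i G ih =>
    refine ⟨(isSmooth_const _).mul ((ih _).1.sub (ih k).1), ?_⟩
    change _ = (k i : ℂ) • (eulerWord G (fun k => coef (σ k)) (k + Pi.single i 1) -
      eulerWord G (fun k => coef (σ k)) k)
    rw [← (ih _).2, ← (ih k).2]
    funext j
    rw [Pi.smul_apply, Pi.sub_apply, smul_eq_mul,
      ← coef_sub (ih _).1.continuous (ih k).1.continuous, ← coef_const_mul]
    rfl

/-- Coefficients are bounded by suprema, and falling factorials dominate powers of the bracket;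
conversely, suprema are bounded by the sum of the coefficients. -/
lemma mem_symbolS_iff (h : IsWeight μ Λ) {s : ℝ} {F : (Fin n → ℤ) → UnitAddTorus (Fin n) → ℂ} :
    F ∈ symbolS ρ Λ s ↔ (∀ k, IsSmooth (F k)) ∧ ∀ L : List (Fin n),
      IsWordBounded (fun k => Λ k ^ ρ) (fun k => Λ k ^ s) (L.map fun i => (i, false))
        fun k => coef (F k) := by
  have hW : ∀ (L : List (Fin n)) (k : Fin n → ℤ),
      wordWeight (fun k => Λ k ^ ρ) (L.map fun i => (i, false)) k = (Λ k ^ ρ) ^ L.length := by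
    intro L k
    simpa [wordWeight] using wordWeight_map_false_append (fun k => Λ k ^ ρ) L [] k
  refine and_congr_right fun hF => ⟨fun hb L M => ?_, fun hb α β => ?_⟩
  · obtain ⟨C, S, hC, hS⟩ := bracket_pow_le_sum_miFalling n M
    choose B hB0 hB using fun β => hb (fun i => L.count i) β
    have hlen : miLength (fun i => L.count i) = L.length := by
      rw [← length_multiWord]
      exact (multiWord_perm fun _ => rfl).length_eq
    simp only [← wordDiff_eq_latticeDiff, hlen, h.rpow_sub_mul_natCast] at hB
    refine ⟨C * ∑ β ∈ S, B β, mul_nonneg hC (Finset.sum_nonneg fun β _ => (hB0 β).le),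
      fun k j => ?_⟩
    obtain ⟨hsm, hco⟩ := isSmooth_wordDiff_and_coef hF L k
    have hθ : 0 < (Λ k ^ ρ) ^ L.length := pow_pos (Real.rpow_pos_of_pos (h.pos k) _) _
    rw [List.map_map, hW]
    simp only [Function.comp_def, List.map_id']
    rw [← hco]
    set g := wordDiff L F k
    have h1 : ‖coef g j‖ * bracket j ^ M ≤
        C * ∑ β ∈ S, B β * (Λ k ^ s / (Λ k ^ ρ) ^ L.length) := by
      calc ‖coef g j‖ * bracket j ^ M ≤ ‖coef g j‖ * (C * ∑ β ∈ S, ‖miFalling j β‖) := by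
            gcongr; exact hS j
        _ = C * ∑ β ∈ S, ‖coef (torusDiff β g) j‖ := by
            simp only [coef_torusDiff hsm, norm_mul, ← Finset.sum_mul]; ring
        _ ≤ _ := by gcongr with β; exact norm_coef_le (hB β k) j
    rw [← Finset.sum_mul] at h1
    calc _ = ‖coef g j‖ * bracket j ^ M * (Λ k ^ ρ) ^ L.length := by ring
      _ ≤ C * ((∑ β ∈ S, B β) * (Λ k ^ s / (Λ k ^ ρ) ^ L.length)) * (Λ k ^ ρ) ^ L.length := by
          gcongr
      _ = _ := by field_simp
  · obtain ⟨C, K, hC, hmf⟩ := norm_miFalling_le β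
    -- `K` pays for the falling factorial of `D_x^{(β)}`, and `2 * n` for the sum over `j`.
    obtain ⟨D, hD, hDle⟩ := hb (multiWord α) (K + 2 * n)
    have hsum := summable_inv_bracket_pow n
    set T := ∑' j : Fin n → ℤ, (bracket j ^ (2 * n))⁻¹
    have hT : 0 ≤ T := tsum_nonneg fun j => inv_nonneg.2 (pow_nonneg (bracket_pos j).le _)
    -- The `1` makes the constant strictly positive, as the symbol class demands.
    refine ⟨C * D * T + 1, by positivity, fun k x => ?_⟩
    have hΛ : 0 < Λ k ^ s := Real.rpow_pos_of_pos (h.pos k) s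
    have hθ : 0 < (Λ k ^ ρ) ^ (multiWord α).length :=
      pow_pos (Real.rpow_pos_of_pos (h.pos k) _) _
    rw [h.rpow_sub_mul_natCast, ← length_multiWord, latticeDiff_eq_wordDiff]
    obtain ⟨hsm, hco⟩ := isSmooth_wordDiff_and_coef hF (multiWord α) k
    have h1 : ∀ j, ‖coef (torusDiff β (wordDiff (multiWord α) F k)) j‖ ≤
        C * D * (Λ k ^ s / (Λ k ^ ρ) ^ (multiWord α).length) * (bracket j ^ (2 * n))⁻¹ := by
      intro j
      have h2 := hDle k j
      rw [List.map_map, hW] at h2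
      simp only [Function.comp_def, List.map_id'] at h2
      rw [← hco] at h2
      rw [coef_torusDiff hsm, norm_mul, ← div_eq_mul_inv,
        le_div_iff₀ (pow_pos (bracket_pos j) _), mul_div_assoc', le_div_iff₀ hθ]
      set g := wordDiff (multiWord α) F k
      have hj := bracket_pos j
      calc _ ≤ C * bracket j ^ K * ‖coef g j‖ * bracket j ^ (2 * n) *
            (Λ k ^ ρ) ^ (multiWord α).length := by gcongr; exact hmf j
        _ = C * (‖coef g j‖ * (Λ k ^ ρ) ^ (multiWord α).length * bracket j ^ (K + 2 * n)) := by
            ring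
        _ ≤ C * (D * Λ k ^ s) := by gcongr
        _ = _ := by ring
    calc _ ≤ ∑' j, ‖coef (torusDiff β (wordDiff (multiWord α) F k)) j‖ :=
          norm_le_tsum_coef (isSmooth_torusDiff hsm β) x
      _ ≤ ∑' j, C * D * (Λ k ^ s / (Λ k ^ ρ) ^ (multiWord α).length) *
            (bracket j ^ (2 * n))⁻¹ :=
          Summable.tsum_le_tsum h1 (summable_norm_of_mem_latticeSchwartz
            (coef_mem_latticeSchwartz (isSmooth_torusDiff hsm β))) (hsum.mul_left _)
      _ = C * D * T * (Λ k ^ s / (Λ k ^ ρ) ^ (multiWord α).length) := by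
          rw [tsum_mul_left]; ring
      _ ≤ _ := by gcongr; linarith

lemma eulerWord_perm {G : Type*} [AddCommGroup G] [Module ℂ G] {L L' : List (Fin n)}
    (hL : L.Nodup) (hp : L.Perm L') (f : (Fin n → ℤ) → G) : eulerWord L f = eulerWord L' f := by
  funext k
  rw [eulerWord_eq_of_nodup hL, eulerWord_eq_of_nodup (hp.nodup_iff.1 hL), wordDiff_perm hp,
    (hp.map _).prod_eq]

/-- A symbol belongs to `M^s_{ρ,Λ}` if and only if its Fourier coefficients satisfy the
corresponding estimates. -/
theorem mem_symbolM_iff (h : IsWeight μ Λ) (hρ : 0 < ρ) {s : ℝ}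
    {σ : (Fin n → ℤ) → UnitAddTorus (Fin n) → ℂ} :
    σ ∈ symbolM ρ Λ s ↔ (∀ k, IsSmooth (σ k)) ∧
      (fun k => coef (σ k)) ∈ coefClass (fun k => Λ k ^ ρ) fun k => Λ k ^ s := by
  obtain ⟨c, hc, hcθ⟩ := h.exists_one_le_mul_rpow hρ
  have hθ : ∀ k, 0 < Λ k ^ ρ := fun k => Real.rpow_pos_of_pos (h.pos k) ρ
  refine and_congr_right fun hσ => ?_
  have e : ∀ γ : Fin n → ℕ, (∀ i, γ i ≤ 1) →
      (fun k x => (∏ i, (k i : ℂ) ^ γ i) * latticeDiff γ σ k x) = eulerWord (multiWord γ) σ :=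
    fun γ hγ => funext fun k => pow_smul_latticeDiff_eq_eulerWord hγ σ k
  have hco : ∀ G, (fun k => coef (eulerWord G σ k)) = eulerWord G fun k => coef (σ k) :=
    fun G => funext fun k => (isSmooth_eulerWord_and_coef hσ G k).2
  constructor
  · intro hM
    refine mem_coefClass_of_eulerWord hθ (zero_le_one.trans hc) hcθ fun G hG L => ?_
    have h1 := hM (fun i => G.count i) (List.nodup_iff_count_le_one.1 hG)
    rw [e _ (List.nodup_iff_count_le_one.1 hG), mem_symbolS_iff h] at h1
    have h2 := h1.2 L
    rwa [hco, eulerWord_perm (nodup_multiWord (List.nodup_iff_count_le_one.1 hG))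
      (multiWord_perm fun _ => rfl)] at h2
  · intro ha γ hγ
    rw [e γ hγ, mem_symbolS_iff h]
    refine ⟨fun k => (isSmooth_eulerWord_and_coef hσ _ k).1, fun L => ?_⟩
    rw [hco]
    refine isWordBounded_eulerWord hθ ha _ _ ?_
    rw [markedLetters_map_false]
    exact nodup_multiWord hγ

end SymbolClasses

/-! ### The operators on rapidly decreasing functions. -/

section Operators

open UnitAddTorus

/-- A pseudo-differential operator in terms of the Fourier coefficients of its symbol. -/
lemma pdo_eq_tsum {σ : (Fin n → ℤ) → UnitAddTorus (Fin n) → ℂ} {k : Fin n → ℤ}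
    (hσ : IsSmooth (σ k)) {f : (Fin n → ℤ) → ℂ} (hf : f ∈ latticeSchwartz n) :
    pdo σ f k = ∑' p, coef (σ k) p * f (k + p) := by
  have h1 := hasSum_integral_mFourier (summable_norm_of_mem_latticeSchwartz hf) (fun q => -q)
    (h := fun x => mFourier k x * σ k x) (by have := hσ.continuous; fun_prop)
  have e1 : ∀ q, f q * ∫ x, mFourier (-q) x * (mFourier k x * σ k x) ∂(torusMeasure n) =
      coef (σ k) (q - k) * f q := by
    intro q
    rw [mul_comm]
    simp only [coef, ← mul_assoc, ← mFourier_add, neg_sub]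
    rw [neg_add_eq_sub]
  have e2 : pdo σ f k = ∫ x, (∑' q, f q * mFourier (-q) x) * (mFourier k x * σ k x)
      ∂(torusMeasure n) := by
    simp only [pdo, latticeFourier, mul_comm]
  rw [e2, ← h1.tsum_eq, tsum_congr e1, ← (Equiv.addLeft k).tsum_eq]
  simp

/-- In `∑_p a(k,p) f(k+p)`, decay in `p` and in `k + p` together give decay in `k`, by
submultiplicativity of the bracket. Temperateness at the origin makes `Λ(k)^s` grow at most like a
power `K`. -/
lemma pdo_mem_latticeSchwartz {μ ρ s : ℝ} {Λ : (Fin n → ℤ) → ℝ} (h : IsWeight μ Λ) (hρ : 0 < ρ)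
    {σ : (Fin n → ℤ) → UnitAddTorus (Fin n) → ℂ} (hσ : σ ∈ symbolM ρ Λ s)
    {f : (Fin n → ℤ) → ℂ} (hf : f ∈ latticeSchwartz n) : pdo σ f ∈ latticeSchwartz n := by
  obtain ⟨hsm, ha⟩ := (mem_symbolM_iff h hρ).1 hσ
  obtain ⟨-, B, K, hB, hΛ⟩ := h.isTemperate_rpow s
  refine mem_latticeSchwartz_iff.2 fun M => ?_
  obtain ⟨C, hC, hCle⟩ := ha [] List.nodup_nil (M + K + 2 * n)
  obtain ⟨D, hD⟩ := mem_latticeSchwartz_iff.1 hf (M + K)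
  have hD0 : 0 ≤ D := (mul_nonneg (norm_nonneg _) (pow_nonneg (bracket_pos 0).le _)).trans (hD 0)
  have hsum := summable_inv_bracket_pow n
  have hΛ0 : 0 < Λ 0 ^ s := Real.rpow_pos_of_pos (h.pos 0) s
  refine ⟨C * (B * Λ 0 ^ s) * D * ∑' j : Fin n → ℤ, (bracket j ^ (2 * n))⁻¹, fun k => ?_⟩
  have hk := bracket_pos k
  rw [← le_div_iff₀ (by positivity), pdo_eq_tsum (hsm k) hf]
  have hbd : ∀ p, ‖coef (σ k) p * f (k + p)‖ ≤
      C * (B * Λ 0 ^ s) * D / bracket k ^ M * (bracket p ^ (2 * n))⁻¹ := by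
    intro p
    have hp := bracket_pos p
    have hkp := bracket_pos (k + p)
    have h1 := hCle k p
    simp only [List.map_nil, wordDiff_nil, wordWeight, List.prod_nil, mul_one] at h1
    have h2 := hD (k + p)
    have h3 := hΛ 0 k
    rw [zero_add] at h3
    have h4 : bracket k ≤ bracket (k + p) * bracket p := by
      have := bracket_add_le (k + p) (-p)
      rwa [add_neg_cancel_right, bracket_neg] at this
    rw [norm_mul, div_mul_eq_mul_div, ← div_eq_mul_inv, div_div, le_div_iff₀ (by positivity)]
    set X := ‖coef (σ k) p‖
    set Y := ‖f (k + p)‖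
    -- The additional factor `bracket k ^ K` cancels the growth of `Λ(k)^s`.
    refine le_of_mul_le_mul_right ?_ (pow_pos hk K)
    calc X * Y * (bracket p ^ (2 * n) * bracket k ^ M) * bracket k ^ K
        = X * Y * bracket p ^ (2 * n) * bracket k ^ (M + K) := by ring
      _ ≤ X * Y * bracket p ^ (2 * n) * (bracket (k + p) * bracket p) ^ (M + K) := by gcongr
      _ = (X * bracket p ^ (M + K + 2 * n)) * (Y * bracket (k + p) ^ (M + K)) := by ring
      _ ≤ (C * (B * bracket k ^ K * Λ 0 ^ s)) * D := by
          have := Real.rpow_pos_of_pos (h.pos k) s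
          refine mul_le_mul (h1.trans ?_) h2 (by positivity) (by positivity)
          gcongr
      _ = _ := by ring
  refine (tsum_of_norm_bounded (hsum.mul_left _).hasSum hbd).trans (le_of_eq ?_)
  rw [tsum_mul_left]
  ring

end Operators

/-! ### The composite symbol and its expansion. -/

section Composition

variable {Λ : (Fin n → ℤ) → ℝ} {μ ρ m₁ m₂ : ℝ}

lemma taylorRem_zero_left (j : Fin n → ℤ) (v : (Fin n → ℤ) → ℂ) (k : Fin n → ℤ) :
    taylorRem 0 j v k = v (k + j) := by simp [taylorRem]

/-- The operator product in coefficient form: substitute `l = p + q` and exchange the sums. Absolute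
convergence of the double series comes from `exists_wordDiff_comp_le` with the empty word and `N = M
= 0`. -/
lemma tsum_compCoef_mul {θ v w : (Fin n → ℤ) → ℝ} (hθ : IsTemperate θ) {c : ℝ} (hc : 1 ≤ c)
    (hcθ : ∀ k, 1 ≤ c * θ k) (hv : ∀ k, 0 < v k) (hw : IsTemperate w)
    {a b : (Fin n → ℤ) → (Fin n → ℤ) → ℂ} (ha : a ∈ coefClass θ v) (hb : b ∈ coefClass θ w)
    {f : (Fin n → ℤ) → ℂ} (hf : f ∈ latticeSchwartz n) (k : Fin n → ℤ) :
    ∑' p, a k p * ∑' q, b (k + p) q * f (k + p + q) = ∑' l, compCoef 0 a b k l * f (k + l) := by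
  obtain ⟨C, -, hC⟩ := exists_wordDiff_comp_le hθ hc hcθ hv hw ha hb 0 0 (W := [])
    List.nodup_nil
  simp only [List.map_nil, wordDiff_nil, wordWeight, List.prod_nil, mul_one, pow_zero,
    div_one, taylorRem_zero_left] at hC
  have hfk : Summable fun l => ‖f (k + l)‖ :=
    ((Equiv.addLeft k).summable_iff (f := fun l => ‖f l‖)).2
      (summable_norm_of_mem_latticeSchwartz hf)
  have hs : Summable fun x : (Fin n → ℤ) × (Fin n → ℤ) =>
      a k x.1 * b (k + x.1) (x.2 - x.1) * f (k + x.2) := by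
    refine Summable.of_norm_bounded (((summable_inv_bracket_pow n).mul_left
      (C * (v k * w k))).mul_of_nonneg hfk (fun j => ?_) fun _ => norm_nonneg _) fun x => ?_
    · exact (norm_nonneg _).trans (hC j 0 k)
    · rw [norm_mul]
      gcongr
      exact hC x.1 x.2 k
  have h1 : ∀ p, a k p * ∑' q, b (k + p) q * f (k + p + q) =
      ∑' l, a k p * b (k + p) (l - p) * f (k + l) := by
    intro p
    rw [← tsum_mul_left]
    refine Eq.trans ?_ ((Equiv.addLeft p).tsum_eq _)
    simp [add_assoc, mul_assoc]
  rw [tsum_congr h1, ← Summable.tsum_comm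
    (f := fun p l => a k p * b (k + p) (l - p) * f (k + l)) hs]
  refine tsum_congr fun l => ?_
  rw [tsum_mul_right, compCoef]
  simp only [taylorRem_zero_left]

/-- Termwise this is the definition of the Taylor remainder, so only convergence of each expansion
term is needed. In the application `t α` is the Fourier coefficient of the term of index `α`. -/
lemma compCoef_eq_sub {θ v w : (Fin n → ℤ) → ℝ} (hθ : IsTemperate θ) {c : ℝ} (hc : 1 ≤ c)
    (hcθ : ∀ k, 1 ≤ c * θ k) (hv : ∀ k, 0 < v k) (hw : IsTemperate w)
    {a b : (Fin n → ℤ) → (Fin n → ℤ) → ℂ} (ha : a ∈ coefClass θ v) (hb : b ∈ coefClass θ w)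
    (N : ℕ) (k l : Fin n → ℤ) {t : (Fin n → ℕ) → ℂ}
    (ht : ∀ α, HasSum (fun j => 1 / (miFactorial α : ℂ) * (miFalling j α * a k j) *
      latticeDiff α b k (l - j)) (t α)) :
    compCoef N a b k l = compCoef 0 a b k l -
      ∑ d ∈ Finset.range N, ∑ α ∈ (Finset.univ : Finset (Fin n)).piAntidiag d, t α := by
  have h0 := (summable_compCoef hθ hc hcθ hv hw ha hb 0 k l).hasSum
  have h1 := h0.sub (hasSum_sum (s := Finset.range N) fun d _ =>
    hasSum_sum (s := (Finset.univ : Finset (Fin n)).piAntidiag d) fun α _ => ht α)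
  rw [compCoef, compCoef, ← h1.tsum_eq]
  refine tsum_congr fun j => ?_
  rw [taylorRem_zero_left, taylorRem, mul_sub, Finset.mul_sum]
  congr 1
  refine Finset.sum_congr rfl fun d _ => ?_
  rw [taylorTerm, Finset.mul_sum]
  refine Finset.sum_congr rfl fun α _ => ?_
  rw [miBinom_eq, latticeDiff_eq_wordDiff, latticeDiff_eq_wordDiff, wordDiff_apply]
  ring

lemma isSmooth_compositionExpansion {σ τ : (Fin n → ℤ) → UnitAddTorus (Fin n) → ℂ}
    (hσ : ∀ k, IsSmooth (σ k)) (hτ : ∀ k, IsSmooth (τ k)) (N : ℕ) (k : Fin n → ℤ) :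
    IsSmooth (compositionExpansion σ τ N k) := by
  refine IsSmooth.sum fun d _ => IsSmooth.sum fun α _ => ?_
  rw [latticeDiff_eq_wordDiff]
  exact ((isSmooth_const _).mul (isSmooth_torusDiff (hσ k) α)).mul
    (isSmooth_wordDiff_and_coef hτ _ k).1

/-- Products become convolutions and `D_x^{(α)}` becomes multiplication by `j^{(α)}`. The values `t`
are exposed in the form that `compCoef_eq_sub` consumes. -/
lemma coef_compositionExpansion {σ τ : (Fin n → ℤ) → UnitAddTorus (Fin n) → ℂ}
    (hσ : ∀ k, IsSmooth (σ k)) (hτ : ∀ k, IsSmooth (τ k)) (N : ℕ) (k l : Fin n → ℤ) :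
    ∃ t : (Fin n → ℕ) → ℂ, (∀ α, HasSum (fun j => 1 / (miFactorial α : ℂ) *
        (miFalling j α * coef (σ k) j) * latticeDiff α (fun k => coef (τ k)) k (l - j)) (t α)) ∧
      coef (compositionExpansion σ τ N k) l =
        ∑ d ∈ Finset.range N, ∑ α ∈ (Finset.univ : Finset (Fin n)).piAntidiag d, t α := by
  have hsm : ∀ α, IsSmooth (latticeDiff α τ k) := fun α => by
    rw [latticeDiff_eq_wordDiff]
    exact (isSmooth_wordDiff_and_coef hτ _ k).1
  have hprod : ∀ α, IsSmooth fun x =>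
      1 / (miFactorial α : ℂ) * torusDiff α (σ k) x * latticeDiff α τ k x := fun α =>
    ((isSmooth_const _).mul (isSmooth_torusDiff (hσ k) α)).mul (hsm α)
  refine ⟨fun α => coef (fun x =>
    1 / (miFactorial α : ℂ) * torusDiff α (σ k) x * latticeDiff α τ k x) l, fun α => ?_, ?_⟩
  · have h1 := hasSum_coef_mul (g := fun x => 1 / (miFactorial α : ℂ) * torusDiff α (σ k) x)
      ((isSmooth_const _).mul (isSmooth_torusDiff (hσ k) α)) (hsm α).continuous l
    simp only [coef_const_mul, coef_torusDiff (hσ k)] at h1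
    convert h1 using 4 with j
    rw [latticeDiff_eq_wordDiff, latticeDiff_eq_wordDiff,
      (isSmooth_wordDiff_and_coef hτ _ k).2]
  · unfold compositionExpansion
    rw [coef_sum fun d _ => (IsSmooth.sum fun α _ => hprod α).continuous]
    exact Finset.sum_congr rfl fun d _ => coef_sum (fun α _ => (hprod α).continuous) l

end Composition

end LatticePDO

end

theorem mainTheorem1 (n : ℕ) (μ : ℝ) (Λ : (Fin n → ℤ) → ℝ) (hΛ : LatticePDO.IsWeight μ Λ)
    (ρ : ℝ) (hρ0 : 0 < ρ) (hρ1 : ρ ≤ 1 / μ) (m₁ m₂ : ℝ)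
    (σ τ : (Fin n → ℤ) → UnitAddTorus (Fin n) → ℂ)
    (hσ : σ ∈ LatticePDO.symbolM ρ Λ m₁) (hτ : τ ∈ LatticePDO.symbolM ρ Λ m₂) :
    Set.MapsTo (LatticePDO.pdo σ) (LatticePDO.latticeSchwartz n) (LatticePDO.latticeSchwartz n) ∧
    Set.MapsTo (LatticePDO.pdo τ) (LatticePDO.latticeSchwartz n) (LatticePDO.latticeSchwartz n) ∧
    ∃ l ∈ LatticePDO.symbolM ρ Λ (m₁ + m₂),
      (∀ f ∈ LatticePDO.latticeSchwartz n,
        LatticePDO.pdo σ (LatticePDO.pdo τ f) = LatticePDO.pdo l f) ∧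
      ∀ N : ℕ, (fun k x => l k x - LatticePDO.compositionExpansion σ τ N k x) ∈
        LatticePDO.symbolM ρ Λ (m₁ + m₂ - ρ * N) := by
  open LatticePDO in
  refine ⟨fun f hf => pdo_mem_latticeSchwartz hΛ hρ0 hσ hf,
    fun f hf => pdo_mem_latticeSchwartz hΛ hρ0 hτ hf, ?_⟩
  obtain ⟨hσs, ha⟩ := (mem_symbolM_iff hΛ hρ0).1 hσ
  obtain ⟨hτs, hb⟩ := (mem_symbolM_iff hΛ hρ0).1 hτ
  obtain ⟨c, hc, hcθ⟩ := hΛ.exists_one_le_mul_rpow hρ0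
  have hθ := hΛ.isTemperate_rpow ρ
  have hv := (hΛ.isTemperate_rpow m₁).1
  have hw := hΛ.isTemperate_rpow m₂
  set a := fun k => coef (σ k)
  set b := fun k => coef (τ k)
  have hcomp : ∀ N : ℕ, compCoef N a b ∈
      coefClass (fun k => Λ k ^ ρ) fun k => Λ k ^ (m₁ + m₂ - ρ * N) := by
    intro N
    have := compCoef_mem_coefClass hθ hc hcθ hv hw ha hb N
    simpa only [hΛ.rpow_sub_mul_natCast, Real.rpow_add (hΛ.pos _)] using this
  have hrow : ∀ k, compCoef 0 a b k ∈ latticeSchwartz n := row_mem_latticeSchwartz (hcomp 0)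
  have hls : ∀ k, IsSmooth (synth (compCoef 0 a b k)) := fun k => isSmooth_synth (hrow k)
  have hlc : ∀ k, coef (synth (compCoef 0 a b k)) = compCoef 0 a b k := fun k =>
    funext fun l => coef_synth (hrow k) l
  -- Order zero means that no Taylor term is removed, so this is the exact composite symbol, the
  -- same for all `N`.
  refine ⟨fun k => synth (compCoef 0 a b k), ?_, fun f hf => ?_, fun N => ?_⟩
  · rw [mem_symbolM_iff hΛ hρ0]
    refine ⟨hls, ?_⟩
    simp only [hlc]
    simpa using hcomp 0
  · funext k
    rw [pdo_eq_tsum (hσs k) (pdo_mem_latticeSchwartz hΛ hρ0 hτ hf), pdo_eq_tsum (hls k) hf, hlc,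
      ← tsum_compCoef_mul hθ hc hcθ hv hw ha hb hf k]
    exact tsum_congr fun p => by rw [pdo_eq_tsum (hτs _) hf]
  · rw [mem_symbolM_iff hΛ hρ0]
    have hes := isSmooth_compositionExpansion hσs hτs N
    refine ⟨fun k => (hls k).sub (hes k), ?_⟩
    -- The coefficients of the error are exactly `compCoef N`, whose order is already known.
    convert hcomp N using 1
    funext k l
    rw [coef_sub (hls k).continuous (hes k).continuous, hlc]
    obtain ⟨t, ht, he⟩ := coef_compositionExpansion hσs hτs N k l
    rw [he, compCoef_eq_sub hθ hc hcθ hv hw ha hb N k l ht]
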